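/- Write $\log_k$ for the $k$-fold iterated logarithm. Fix real constants $0<\gamma<\tfrac12$ and $2<a<1/\gamma$. Let $M$ be a positive integer (large enough that $\log_3 M>0$), let $-D<0$ be a fundamental discriminant, and for each nonzero prime ideal $\mathfrak p$ of the ring of integers of $\mathbb{Q}(\sqrt{-D})$ let $p$ denote the rational prime below $\mathfrak p$; $N$ denotes the ideal norm. For $k=1,2,\dots,\lfloor(\log_2 M)^\gamma\rfloor-1$ let $\mathbb{P}_k$ be the set of prime ideals $\mathfrak p$ with $$e^{k}\log M\log_2 M<p\le e^{k+1}\log M\log_2 M,$$ and let $\mathbb{P}=\bigcup_k\mathbb{P}_k$, so that $\mathbb{P}$ consists of the prime ideals above the primes in $(e\log M\log_2 M,\ \exp(\lfloor(\log_2 M)^\gamma\rfloor)\log M\log_2 M]$. Let $f$ be the multiplicative function on ideals supported on the squarefree ideals all of whose prime factors lie in $\mathbb{P}$, with $$f(\mathfrak p)=\sqrt{\frac{\log M\log_2 M}{\log_3 M}}\cdot\frac{1}{\sqrt p\,(\log p-\log_2 M-\log_3 M)}\qquad(\mathfrak p\in\mathbb{P}),$$ and let $\mathcal{M}$ be the set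 of ideals in the support of $f$ that have, for every $k=1,\dots,\lfloor(\log_2 M)^\gamma\rfloor-1$, fewer than $\dfrac{a\log M}{k^2\log_3 M}$ prime factors in $\mathbb{P}_k$. Then, for all $M$ sufficiently large in terms of $\gamma$ and $a$ only (in particular uniformly in $D$), the set $\mathcal{M}$ has at most $M$ elements. Moreover, when in addition $M\le D$, $$\frac{1}{\sum_{\mathfrak m\in\mathcal{M}}f(\mathfrak m)^2}\sum_{\substack{\mathfrak m,\mathfrak n\in\mathcal{M},\ \mathfrak m\mid\mathfrak n\\ N(\mathfrak n/\mathfrak m)<\sqrt D}}\frac{f(\mathfrak m)f(\mathfrak n)}{\sqrt{N(\mathfrak n/\mathfrak m)}}\ \ge\ \exp\Bigg((1+o(1))\sqrt{\frac{\log M\log_2 M}{\log_3 M}}\sum_{\mathfrak p\in\mathbb{P}}\frac{1}{\sqrt{N\mathfrak p}}\,\frac{1}{\sqrt p\,(\log p-\log_2 M-\log_3 M)}+o(1)\Bigg),$$ where both $o(1)$ terms tend to $0$ as $M\to\infty$ for fixed $\gamma$ and $a$, uniformly in $D$. -/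

import Mathlib

open Filter Topology NumberField

noncomputable section

namespace Resonance

/-- `d` is a fundamental discriminant: either `d ≡ 1 (mod 4)` is squarefree and `d ≠ 1`, or
`d = 4 m` with `m ≡ 2, 3 (mod 4)` squarefree. -/
def IsFundamentalDiscriminant (d : ℤ) : Prop :=
  (d ≠ 1 ∧ d % 4 = 1 ∧ Squarefree d) ∨
    ∃ m : ℤ, d = 4 * m ∧ (m % 4 = 2 ∨ m % 4 = 3) ∧ Squarefree m

/-- `K` is (a model of) the field `ℚ(√-D)`. -/
def IsQSqrtNeg (D : ℕ) (K : Type*) [Field K] [CharZero K] : Prop :=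
  ∃ x : K, x ^ 2 = -(D : K) ∧ IntermediateField.adjoin ℚ {x} = ⊤

/-- The `k`-fold iterated logarithm `log_k`. -/
def iterLog (k : ℕ) (x : ℝ) : ℝ := Real.log^[k] x

/-- The number `⌊(log₂ M) ^ γ⌋`. -/
def shellCount (γ : ℝ) (M : ℕ) : ℕ := ⌊iterLog 2 M ^ γ⌋₊

variable (K : Type*) [Field K] [NumberField K]

variable {K} in
/-- The rational prime `p` below a nonzero prime ideal `𝔭` (the positive generator of `𝔭 ∩ ℤ`). -/
def primeBelow (𝔭 : Ideal (𝓞 K)) : ℕ := Ideal.absNorm (Ideal.under ℤ 𝔭)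

/-- The set `ℙ_k` of prime ideals above primes in
`(e ^ k log M log₂ M, e ^ (k + 1) log M log₂ M]`. -/
def shellPrimes (M k : ℕ) : Set (Ideal (𝓞 K)) :=
  {𝔭 | 𝔭.IsPrime ∧ 𝔭 ≠ ⊥ ∧
    Real.exp k * (iterLog 1 M * iterLog 2 M) < primeBelow 𝔭 ∧
    primeBelow 𝔭 ≤ Real.exp (k + 1) * (iterLog 1 M * iterLog 2 M)}

/-- The set `ℙ`, the union of the `ℙ_k` over `k = 1, …, ⌊(log₂ M) ^ γ⌋ - 1`. -/
def resonatorPrimes (γ : ℝ) (M : ℕ) : Set (Ideal (𝓞 K)) :=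
  ⋃ k ∈ Finset.Icc 1 (shellCount γ M - 1), shellPrimes K M k

/-- The squarefree ideals generated by the prime ideals in `ℙ`. -/
def supportIdeals (γ : ℝ) (M : ℕ) : Set (Ideal (𝓞 K)) :=
  {𝔫 | Squarefree 𝔫 ∧ ∀ 𝔭 ∈ UniqueFactorizationMonoid.primeFactors 𝔫, 𝔭 ∈ resonatorPrimes K γ M}

variable {K} in
/-- The factor `1 / (√p (log p - log₂ M - log₃ M))` attached to a prime ideal `𝔭` above `p`. -/
def primeWeight (M : ℕ) (𝔭 : Ideal (𝓞 K)) : ℝ :=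
  1 / (√(primeBelow 𝔭 : ℝ) * (Real.log (primeBelow 𝔭) - iterLog 2 M - iterLog 3 M))

/-- The factor `√(log M log₂ M / log₃ M)`. -/
def amplitude (M : ℕ) : ℝ := √(iterLog 1 M * iterLog 2 M / iterLog 3 M)

open scoped Classical in
variable {K} in
/-- The multiplicative function `f` supported on the squarefree ideals generated by `ℙ`, with
`f(𝔭) = √(log M log₂ M / log₃ M) / (√p (log p - log₂ M - log₃ M))` for `𝔭 ∈ ℙ`. -/
def resonator (γ : ℝ) (M : ℕ) (𝔫 : Ideal (𝓞 K)) : ℝ :=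
  if 𝔫 ∈ supportIdeals K γ M then
    ∏ 𝔭 ∈ UniqueFactorizationMonoid.primeFactors 𝔫, amplitude M * primeWeight M 𝔭
  else 0

open scoped Classical in
/-- The set `𝓜`: ideals in the support of `f` that have, for each
`k = 1, …, ⌊(log₂ M) ^ γ⌋ - 1`, fewer than `a log M / (k² log₃ M)` prime factors in `ℙ_k`. -/
def resonatorSet (γ a : ℝ) (M : ℕ) : Set (Ideal (𝓞 K)) :=
  {𝔫 ∈ supportIdeals K γ M | ∀ k ∈ Finset.Icc 1 (shellCount γ M - 1),
    (((UniqueFactorizationMonoid.primeFactors 𝔫).filter (· ∈ shellPrimes K M k)).card : ℝ) <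
      a * iterLog 1 M / ((k : ℝ) ^ 2 * iterLog 3 M)}

variable {K} in
/-- The norm `N(𝔫/𝔪) = N𝔫 / N𝔪` (for `𝔪 ∣ 𝔫`). -/
def normQuot (𝔫 𝔪 : Ideal (𝓞 K)) : ℝ := (Ideal.absNorm 𝔫 : ℝ) / Ideal.absNorm 𝔪

/-- The pairs `(𝔪, 𝔫)` in `𝓜 × 𝓜` with `𝔪 ∣ 𝔫` and `N(𝔫/𝔪) < √D`. -/
def resonancePairs (γ a : ℝ) (M D : ℕ) : Set (Ideal (𝓞 K) × Ideal (𝓞 K)) :=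
  {x | x.1 ∈ resonatorSet K γ a M ∧ x.2 ∈ resonatorSet K γ a M ∧ x.1 ∣ x.2 ∧
    normQuot x.2 x.1 < √(D : ℝ)}

/-- The resonance ratio
`(∑_{𝔪 ∈ 𝓜} f(𝔪)²)⁻¹ ∑_{𝔪, 𝔫 ∈ 𝓜, 𝔪 ∣ 𝔫, N(𝔫/𝔪) < √D} f(𝔪) f(𝔫) / √N(𝔫/𝔪)`. -/
def resonanceRatio (γ a : ℝ) (M D : ℕ) : ℝ :=
  1 / (∑ᶠ 𝔪 ∈ resonatorSet K γ a M, resonator γ M 𝔪 ^ 2) *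
    ∑ᶠ x ∈ resonancePairs K γ a M D,
      resonator γ M x.1 * resonator γ M x.2 / √(normQuot x.2 x.1)

/-- The sum `∑_{𝔭 ∈ ℙ} 1 / (√N𝔭 √p (log p - log₂ M - log₃ M))`; it is finite by
`resonatorPrimes_finite`. -/
def primeSum (γ : ℝ) (M : ℕ) : ℝ :=
  ∑ᶠ 𝔭 ∈ resonatorPrimes K γ M, 1 / √(Ideal.absNorm 𝔭 : ℝ) * primeWeight M 𝔭

/-- There are finitely many prime ideals above primes in a bounded interval. -/
theorem shellPrimes_finite (M k : ℕ) : (shellPrimes K M k).Finite := by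
  have key : ∀ p : ℕ, {𝔭 : Ideal (𝓞 K) | 𝔭.IsPrime ∧ 𝔭 ≠ ⊥ ∧ primeBelow 𝔭 = p}.Finite := by
    intro p
    rcases Nat.eq_zero_or_pos p with rfl | hp
    · convert Set.finite_empty
      ext 𝔭
      simp only [Set.mem_ofPred_eq, Set.mem_empty_iff_false, iff_false]
      rintro ⟨h1, h2, h3⟩
      have : NeZero 𝔭 := ⟨h2⟩
      exact (Nat.absNorm_under_prime 𝔭).ne_zero h3
    · have hb : Ideal.span {((p : ℕ) : 𝓞 K)} ≠ ⊥ := by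
        simp [hp.ne']
      refine (Ideal.finite_factors hb |>.image fun v => v.asIdeal).subset ?_
      rintro 𝔭 ⟨h1, h2, h3⟩
      refine ⟨⟨𝔭, h1, h2⟩, ?_, rfl⟩
      simp only [Set.mem_ofPred_eq]
      rw [Ideal.dvd_span_singleton, ← h3]
      exact Int.absNorm_under_mem 𝔭
  refine ((Set.finite_Iic ⌊Real.exp (k + 1) * (iterLog 1 M * iterLog 2 M)⌋₊).biUnion
    fun p _ => key p).subset ?_
  rintro 𝔭 ⟨h1, h2, -, h4⟩
  simp only [Set.mem_iUnion, Set.mem_ofPred_eq, exists_prop]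
  exact ⟨primeBelow 𝔭, Nat.le_floor h4, h1, h2, rfl⟩

/-- The set `ℙ` is finite. -/
theorem resonatorPrimes_finite (γ : ℝ) (M : ℕ) : (resonatorPrimes K γ M).Finite :=
  (Finset.finite_toSet _).biUnion fun k _ => shellPrimes_finite K M k

end Resonance

end

noncomputable section

namespace Resonance

section FejerKernel

open MeasureTheory

/-- The Fejér kernel `∫_{-T}^{T} (1 - |t|/T) cos (t v) dt`. -/
def fejerKernel (T v : ℝ) : ℝ := ∫ t in -T..T, (1 - |t| / T) * Real.cos (t * v)

theorem fejerKernel_eq {T v : ℝ} (hT : 0 < T) (hv : v ≠ 0) :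
    fejerKernel T v = 2 * (1 - Real.cos (T * v)) / (T * v ^ 2) := by
  have hcont : Continuous fun t : ℝ => (1 - |t| / T) * Real.cos (t * v) := by fun_prop
  have hright : ∫ t in (0 : ℝ)..T, (1 - |t| / T) * Real.cos (t * v) =
      (1 - Real.cos (T * v)) / (T * v ^ 2) := by
    have h1 : ∫ t in (0 : ℝ)..T, (1 - |t| / T) * Real.cos (t * v) =
        ∫ t in (0 : ℝ)..T, (1 - t / T) * Real.cos (t * v) := by
      refine intervalIntegral.integral_congr fun t ht => ?_
      rw [Set.uIcc_of_le hT.le] at ht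
      simp only [abs_of_nonneg ht.1]
    rw [h1, intervalIntegral.integral_eq_sub_of_hasDerivAt
      (f := fun t => (1 - t / T) * Real.sin (t * v) / v - Real.cos (t * v) / (T * v ^ 2))]
    · field_simp
      simp
      ring
    · intro t _
      have hs : HasDerivAt (fun t : ℝ => Real.sin (t * v)) (Real.cos (t * v) * v) t := by
        simpa using ((hasDerivAt_id t).mul_const v).sin
      have hc : HasDerivAt (fun t : ℝ => Real.cos (t * v)) (-Real.sin (t * v) * v) t := by
        simpa using ((hasDerivAt_id t).mul_const v).cos
      have hl : HasDerivAt (fun t : ℝ => 1 - t / T) (-(1 / T)) t := by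
        simpa using ((hasDerivAt_id t).div_const T).const_sub 1
      refine (((hl.mul hs).div_const v).sub (hc.div_const (T * v ^ 2))).congr_deriv ?_
      field_simp
      ring
    · exact Continuous.intervalIntegrable (by fun_prop) _ _
  have hleft : ∫ t in (-T)..0, (1 - |t| / T) * Real.cos (t * v) =
      ∫ t in (0 : ℝ)..T, (1 - |t| / T) * Real.cos (t * v) := by
    have := intervalIntegral.integral_comp_neg
      (f := fun t : ℝ => (1 - |t| / T) * Real.cos (t * v)) (a := 0) (b := T)
    simp only [abs_neg, neg_mul, Real.cos_neg, neg_zero] at this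
    exact this.symm
  rw [fejerKernel, ← intervalIntegral.integral_add_adjacent_intervals
    (hcont.intervalIntegrable _ 0) (hcont.intervalIntegrable 0 _), hleft, hright]
  ring

theorem fejerKernel_zero_right {T : ℝ} (hT : 0 < T) : 0 ≤ fejerKernel T 0 := by
  refine intervalIntegral.integral_nonneg (by linarith) fun t ht => ?_
  have : |t| / T ≤ 1 := (div_le_one hT).2 (abs_le.2 ht)
  simp [this]

theorem fejerKernel_nonneg {T : ℝ} (hT : 0 < T) (v : ℝ) : 0 ≤ fejerKernel T v := by
  rcases eq_or_ne v 0 with rfl | hv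
  · exact fejerKernel_zero_right hT
  · rw [fejerKernel_eq hT hv]
    have := Real.cos_le_one (T * v)
    have : 0 ≤ 1 - Real.cos (T * v) := by linarith
    positivity

theorem continuous_fejerKernel (T : ℝ) : Continuous (fejerKernel T) := by
  unfold fejerKernel
  exact intervalIntegral.continuous_parametric_intervalIntegral_of_continuous' (by fun_prop) _ _

theorem fejerKernel_scale {T : ℝ} (hT : 0 < T) (v : ℝ) :
    fejerKernel T v = T * fejerKernel 1 (T * v) := by
  have := intervalIntegral.integral_comp_mul_left
      (f := fun t : ℝ => (1 - |t| / T) * Real.cos (t * v)) (a := -1) (b := 1) hT.ne'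
  simp only [mul_neg, mul_one, smul_eq_mul] at this
  rw [fejerKernel, fejerKernel, eq_comm, ← mul_inv_cancel_left₀ hT.ne' (∫ t in -T..T, _), ← this]
  congr 1
  refine intervalIntegral.integral_congr fun t _ => ?_
  simp only [abs_mul, abs_of_pos hT, div_one]
  rw [mul_div_cancel_left₀ _ hT.ne']
  ring_nf

theorem fejerKernel_one_le (v : ℝ) : fejerKernel 1 v ≤ 8 * (1 + v ^ 2)⁻¹ := by
  have hle : fejerKernel 1 v ≤ 2 := by
    have : fejerKernel 1 v ≤ ∫ t in (-1 : ℝ)..1, (1 : ℝ) := by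
      refine intervalIntegral.integral_mono_on (by norm_num)
        (Continuous.intervalIntegrable (by fun_prop) _ _) (by simp) fun t ht => ?_
      have h1 : |t| ≤ 1 := abs_le.2 ht
      have h2 := Real.cos_le_one (t * v)
      have h3 := abs_nonneg t
      rw [div_one]
      nlinarith
    have h2 : ∫ t in (-1 : ℝ)..1, (1 : ℝ) = 2 := by simp; norm_num
    linarith
  have hpos : (0 : ℝ) < 1 + v ^ 2 := by positivity
  rw [← div_eq_mul_inv, le_div_iff₀ hpos]
  rcases eq_or_ne v 0 with rfl | hv
  · nlinarith
  · have h1 : fejerKernel 1 v * v ^ 2 ≤ 4 := by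
      rw [fejerKernel_eq one_pos hv, one_mul, one_mul, div_mul_cancel₀ _ (by positivity)]
      linarith [Real.neg_one_le_cos v]
    nlinarith

theorem integrable_fejerKernel_one : Integrable (fejerKernel 1) := by
  refine (integrable_inv_one_add_sq.const_mul 8).mono'
    (continuous_fejerKernel 1).aestronglyMeasurable (ae_of_all _ fun v => ?_)
  rw [Real.norm_of_nonneg (fejerKernel_nonneg one_pos v)]
  exact fejerKernel_one_le v

theorem integrable_fejerKernel {T : ℝ} (hT : 0 < T) : Integrable (fejerKernel T) := by
  rw [show fejerKernel T = fun v => T * fejerKernel 1 (T * v) from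
    funext fun v => fejerKernel_scale hT v]
  exact (integrable_fejerKernel_one.comp_mul_left' hT.ne').const_mul T

theorem integral_fejerKernel {T : ℝ} (hT : 0 < T) :
    ∫ v, fejerKernel T v = ∫ v, fejerKernel 1 v := by
  simp_rw [fejerKernel_scale hT]
  rw [integral_const_mul, Measure.integral_comp_mul_left (fejerKernel 1) T, smul_eq_mul,
    abs_of_pos (inv_pos.2 hT), mul_inv_cancel_left₀ hT.ne']

theorem integral_fejerKernel_one_pos : 0 < ∫ v, fejerKernel 1 v := by
  have h0 : fejerKernel 1 0 ≠ 0 := by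
    have hc : Continuous fun t : ℝ => (1 - |t| / 1) * Real.cos (t * 0) := by fun_prop
    refine (intervalIntegral.integral_pos (by norm_num) hc.continuousOn (fun t ht => ?_)
      ⟨0, by norm_num, by norm_num⟩).ne'
    have h1 : |t| ≤ 1 := abs_le.2 ⟨ht.1.le, ht.2⟩
    simp [h1]
  rw [integral_pos_iff_support_of_nonneg (fun v => fejerKernel_nonneg one_pos v)
    integrable_fejerKernel_one]
  exact (continuous_fejerKernel 1).isOpen_support.measure_pos _ ⟨0, h0⟩

theorem tendsto_integral_fejerKernel {η : ℝ} (hη : 0 < η) :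
    Tendsto (fun T : ℝ => ∫ v in -η..η, fejerKernel T v) atTop (𝓝 (∫ v, fejerKernel 1 v)) := by
  have h1 : Tendsto (fun T : ℝ => ∫ v in -(T * η)..(T * η), fejerKernel 1 v) atTop
      (𝓝 (∫ v, fejerKernel 1 v)) :=
    intervalIntegral_tendsto_integral integrable_fejerKernel_one
      (tendsto_neg_atTop_atBot.comp (tendsto_id.atTop_mul_const hη))
      (tendsto_id.atTop_mul_const hη)
  refine h1.congr' ?_
  filter_upwards [eventually_gt_atTop 0] with T hT
  simp_rw [fejerKernel_scale hT]
  rw [intervalIntegral.integral_const_mul, intervalIntegral.integral_comp_mul_left _ hT.ne',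
    smul_eq_mul, mul_inv_cancel_left₀ hT.ne', mul_neg]

end FejerKernel

section Tauberian

open MeasureTheory

open ArithmeticFunction hiding log

/-- The regular part `-ζ'/ζ(s) - 1/(s-1)` at `s = 1 + max σ 0 + i t`, as a continuous function
of `(σ, t)`. -/
def zetaRegularPart (σ t : ℝ) : ℂ :=
  vonMangoldt.LFunctionResidueClassAux (1 : ZMod 1) (1 + (max σ 0 : ℝ) + t * Complex.I)

theorem continuous_zetaRegularPart :
    Continuous fun x : ℝ × ℝ => zetaRegularPart x.1 x.2 := by
  refine (vonMangoldt.continuousOn_LFunctionResidueClassAux (1 : ZMod 1)).comp_continuous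
    (by fun_prop) fun x => ?_
  simp

theorem zetaRegularPart_eq {σ : ℝ} (hσ : 0 < σ) (t : ℝ) :
    zetaRegularPart σ t =
      LSeries (fun n => (vonMangoldt n : ℂ)) (1 + σ + t * Complex.I) - 1 / (σ + t * Complex.I) := by
  have h := vonMangoldt.eqOn_LFunctionResidueClassAux (a := (1 : ZMod 1)) isUnit_one
    (x := 1 + σ + t * Complex.I) (by simpa using hσ)
  have hr : vonMangoldt.residueClass (1 : ZMod 1) = fun n => vonMangoldt n := by
    ext n
    simp [vonMangoldt.residueClass, Set.indicator, eq_iff_true_of_subsingleton]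
  rw [zetaRegularPart, max_eq_left hσ.le, h, hr]
  simp only [Nat.totient_one, Nat.cast_one, inv_one]
  congr 2
  ring

theorem re_integral_exp_eq_fejerKernel (T v : ℝ) :
    (∫ t in -T..T, ((1 - |t| / T : ℝ) : ℂ) * Complex.exp (-(t * v : ℝ) * Complex.I)).re =
      fejerKernel T v := by
  have h := Complex.reCLM.intervalIntegral_comp_comm (μ := volume) (a := -T) (b := T)
    (f := fun t : ℝ => ((1 - |t| / T : ℝ) : ℂ) * Complex.exp (-(t * v : ℝ) * Complex.I))
    (Continuous.intervalIntegrable (by fun_prop) _ _)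
  simp only [Complex.reCLM_apply] at h
  rw [← h, fejerKernel]
  refine intervalIntegral.integral_congr fun t _ => ?_
  simp only [Complex.re_ofReal_mul]
  rw [← Complex.ofReal_neg, Complex.exp_ofReal_mul_I_re, Real.cos_neg]

theorem sum_vonMangoldt_fejerKernel_le_LSeries {T σ : ℝ} (hT : 0 < T) (hσ : 0 < σ) (U : ℝ)
    (s : Finset ℕ) :
    ∑ n ∈ s, vonMangoldt n * (n : ℝ) ^ (-(1 + σ)) * fejerKernel T (Real.log n - U) ≤
      (∫ t in -T..T, ((1 - |t| / T : ℝ) : ℂ) * Complex.exp ((t * U : ℝ) * Complex.I) *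
        LSeries (fun n => (vonMangoldt n : ℂ)) (1 + σ + t * Complex.I)).re := by
  have hre : ∀ t : ℝ, 1 < ((1 : ℂ) + σ + t * Complex.I).re := fun t => by simpa using hσ
  have hsummable : Summable fun n : ℕ => ‖LSeries.term (fun n => (vonMangoldt n : ℂ)) (1 + σ) n‖ := by
    have := (LSeriesSummable_vonMangoldt (s := 1 + σ) (by simpa using hσ)).norm
    exact this
  have hnorm : ∀ (n : ℕ) (t : ℝ), ‖LSeries.term (fun n => (vonMangoldt n : ℂ)) (1 + σ + t * Complex.I) n‖ =
      ‖LSeries.term (fun n => (vonMangoldt n : ℂ)) (1 + σ) n‖ := fun n t => by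
    rw [LSeries.norm_term_eq, LSeries.norm_term_eq]
    simp
  have hsum : HasSum (fun n : ℕ => ∫ t in -T..T, ((1 - |t| / T : ℝ) : ℂ) *
        Complex.exp ((t * U : ℝ) * Complex.I) *
        LSeries.term (fun n => (vonMangoldt n : ℂ)) (1 + σ + t * Complex.I) n)
      (∫ t in -T..T, ((1 - |t| / T : ℝ) : ℂ) * Complex.exp ((t * U : ℝ) * Complex.I) *
        LSeries (fun n => (vonMangoldt n : ℂ)) (1 + σ + t * Complex.I)) := by
    refine intervalIntegral.hasSum_integral_of_dominated_convergence
      (fun n _ => ‖LSeries.term (fun n => (vonMangoldt n : ℂ)) (1 + σ) n‖) (fun n => ?_) (fun n => ?_) ?_ ?_ ?_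
    · refine Continuous.aestronglyMeasurable (Continuous.mul (by fun_prop) ?_)
      rcases eq_or_ne n 0 with rfl | hn
      · simp [LSeries.term_zero, continuous_const]
      · simp only [LSeries.term_of_ne_zero hn]
        have hn' : (n : ℂ) ≠ 0 := by exact_mod_cast hn
        refine Continuous.div continuous_const ?_ fun t => by simp [Complex.cpow_eq_zero_iff, hn']
        exact Continuous.const_cpow (by fun_prop) (Or.inl hn')
    · refine ae_of_all _ fun t ht => ?_
      rw [norm_mul, norm_mul, hnorm, Complex.norm_exp_ofReal_mul_I, mul_one, Complex.norm_real]
      rw [Set.uIoc_of_le (by linarith)] at ht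
      have h1 : |t| ≤ T := abs_le.2 ⟨ht.1.le, ht.2⟩
      have h2 : |t| / T ≤ 1 := (div_le_one hT).2 h1
      have h3 : 0 ≤ |t| / T := by positivity
      rw [Real.norm_of_nonneg (by linarith)]
      exact mul_le_of_le_one_left (norm_nonneg _) (by linarith)
    · exact ae_of_all _ fun _ _ => hsummable
    · simp
    · exact ae_of_all _ fun t _ =>
        (LSeriesSummable_vonMangoldt (hre t)).LSeriesHasSum.mul_left _
  have hterm : ∀ n : ℕ, (∫ t in -T..T, ((1 - |t| / T : ℝ) : ℂ) *
        Complex.exp ((t * U : ℝ) * Complex.I) *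
        LSeries.term (fun n => (vonMangoldt n : ℂ)) (1 + σ + t * Complex.I) n).re =
      vonMangoldt n * (n : ℝ) ^ (-(1 + σ)) * fejerKernel T (Real.log n - U) := by
    intro n
    rcases eq_or_ne n 0 with rfl | hn
    · simp
    have hn' : (n : ℂ) ≠ 0 := by exact_mod_cast hn
    have hpos : (0 : ℝ) < n := by exact_mod_cast hn.bot_lt
    rw [← re_integral_exp_eq_fejerKernel, ← Complex.re_ofReal_mul,
      ← intervalIntegral.integral_const_mul]
    congr 1
    refine intervalIntegral.integral_congr fun t _ => ?_
    simp only [LSeries.term_of_ne_zero hn]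
    rw [div_eq_mul_inv (vonMangoldt n : ℂ), ← Complex.cpow_neg, Complex.cpow_def_of_ne_zero hn',
      Real.rpow_def_of_pos hpos]
    push_cast
    rw [← Complex.ofReal_natCast, ← Complex.ofReal_log hpos.le]
    have : Complex.exp (↑(Real.log ↑n) * -(1 + ↑σ + ↑t * Complex.I)) *
        Complex.exp (↑t * ↑U * Complex.I) = Complex.exp (↑(Real.log ↑n) * -(1 + ↑σ)) *
        Complex.exp (-(↑t * (↑(Real.log ↑n) - ↑U)) * Complex.I) := by
      rw [← Complex.exp_add, ← Complex.exp_add]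
      congr 1
      ring
    linear_combination (1 - ((|t| : ℝ) : ℂ) / T) * (vonMangoldt n : ℂ) * this
  have hre' := Complex.hasSum_re hsum
  simp only [hterm] at hre'
  refine sum_le_hasSum s (fun n _ => ?_) hre'
  exact mul_nonneg (mul_nonneg vonMangoldt_nonneg (by positivity)) (fejerKernel_nonneg hT _)

theorem re_integral_pole_le {T σ : ℝ} (hT : 0 < T) (hσ : 0 < σ) (U : ℝ) :
    (∫ t in -T..T, ((1 - |t| / T : ℝ) : ℂ) * Complex.exp ((t * U : ℝ) * Complex.I) *
        (1 / (σ + t * Complex.I))).re ≤ ∫ v, fejerKernel 1 v := by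
  have hpole : ∀ t : ℝ, 1 / ((σ : ℂ) + t * Complex.I) =
      ∫ v in Set.Ioi (0 : ℝ), Complex.exp (-(σ + t * Complex.I) * v) := fun t => by
    rw [integral_exp_mul_complex_Ioi (by simpa using hσ)]
    rw [Complex.ofReal_zero, mul_zero, Complex.exp_zero, div_neg, neg_div, neg_neg]
  have hswap : ∫ t in -T..T, ((1 - |t| / T : ℝ) : ℂ) * Complex.exp ((t * U : ℝ) * Complex.I) *
        (1 / (σ + t * Complex.I)) =
      ∫ v in Set.Ioi (0 : ℝ), ∫ t in -T..T, ((1 - |t| / T : ℝ) : ℂ) *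
        Complex.exp ((t * U : ℝ) * Complex.I) * Complex.exp (-(σ + t * Complex.I) * v) := by
    simp_rw [hpole, ← integral_const_mul, intervalIntegral.integral_of_le (show -T ≤ T by linarith)]
    refine integral_integral_swap ?_
    have hdom : Integrable (fun x : ℝ × ℝ => (1 : ℝ) * Real.exp (-σ * x.2))
        ((volume.restrict (Set.Ioc (-T) T)).prod (volume.restrict (Set.Ioi (0 : ℝ)))) :=
      Integrable.mul_prod (f := fun _ => (1 : ℝ)) (g := fun v => Real.exp (-σ * v))
        (by simp)
        (exp_neg_integrableOn_Ioi 0 hσ)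
    refine hdom.mono' (Continuous.aestronglyMeasurable (by
      unfold Function.uncurry; fun_prop)) ?_
    rw [Measure.prod_restrict]
    filter_upwards [ae_restrict_mem (measurableSet_Ioc.prod measurableSet_Ioi)] with x hx
    simp only [Function.uncurry]
    rw [norm_mul, norm_mul, Complex.norm_exp_ofReal_mul_I, mul_one, Complex.norm_real]
    have h1 : |x.1| ≤ T := abs_le.2 ⟨hx.1.1.le, hx.1.2⟩
    have h2 : |x.1| / T ≤ 1 := (div_le_one hT).2 h1
    have h3 : 0 ≤ |x.1| / T := by positivity
    rw [Real.norm_of_nonneg (by linarith)]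
    refine mul_le_mul (by linarith) ?_ (norm_nonneg _) zero_le_one
    rw [Complex.norm_exp]
    simp
  have hinner : ∀ v : ℝ, (∫ t in -T..T, ((1 - |t| / T : ℝ) : ℂ) *
        Complex.exp ((t * U : ℝ) * Complex.I) * Complex.exp (-(σ + t * Complex.I) * v)) =
      (Real.exp (-σ * v) : ℂ) * ∫ t in -T..T, ((1 - |t| / T : ℝ) : ℂ) *
        Complex.exp (-(t * (v - U) : ℝ) * Complex.I) := by
    intro v
    rw [← intervalIntegral.integral_const_mul]
    refine intervalIntegral.integral_congr fun t _ => ?_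
    have : Complex.exp ((t * U : ℝ) * Complex.I) * Complex.exp (-(σ + t * Complex.I) * v) =
        (Real.exp (-σ * v) : ℂ) * Complex.exp (-(t * (v - U) : ℝ) * Complex.I) := by
      push_cast
      rw [← Complex.exp_add, ← Complex.exp_add]
      congr 1
      ring
    exact (mul_assoc _ _ _).trans ((congrArg _ this).trans (mul_left_comm _ _ _))
  have hKint : Integrable fun v => fejerKernel T (v - U) :=
    (integrable_fejerKernel hT).comp_sub_right U
  set G : ℝ → ℂ := fun v => (Real.exp (-σ * v) : ℂ) * ∫ t in -T..T, ((1 - |t| / T : ℝ) : ℂ) *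
        Complex.exp (-(t * (v - U) : ℝ) * Complex.I) with hG
  have hGint : IntegrableOn G (Set.Ioi 0) := by
    have hb : IntegrableOn (fun v => Real.exp (-σ * v) * (2 * T)) (Set.Ioi 0) :=
      (exp_neg_integrableOn_Ioi 0 hσ).mul_const _
    refine hb.mono' ?_ (ae_of_all _ fun v => ?_)
    · refine Continuous.aestronglyMeasurable (Continuous.mul (by fun_prop) ?_)
      exact intervalIntegral.continuous_parametric_intervalIntegral_of_continuous'
        (by unfold Function.uncurry; fun_prop) _ _
    · rw [hG, norm_mul, Complex.norm_real, Real.norm_of_nonneg (Real.exp_pos _).le]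
      refine mul_le_mul_of_nonneg_left ?_ (Real.exp_pos _).le
      have := intervalIntegral.norm_integral_le_of_norm_le_const (a := -T) (b := T) (C := 1)
        (f := fun t : ℝ => ((1 - |t| / T : ℝ) : ℂ) *
          Complex.exp (-(t * (v - U) : ℝ) * Complex.I)) fun t ht => by
          rw [Set.uIoc_of_le (by linarith)] at ht
          have h1 : |t| ≤ T := abs_le.2 ⟨ht.1.le, ht.2⟩
          have h2 : |t| / T ≤ 1 := (div_le_one hT).2 h1
          have h3 : 0 ≤ |t| / T := by positivity
          rw [norm_mul, ← Complex.ofReal_neg, Complex.norm_exp_ofReal_mul_I, Complex.norm_real,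
            mul_one, Real.norm_of_nonneg (by linarith)]
          linarith
      refine this.trans ?_
      rw [one_mul, abs_of_pos (by linarith)]
      linarith
  have hre : ∀ v, (G v).re = Real.exp (-σ * v) * fejerKernel T (v - U) := fun v => by
    rw [hG]
    simp only
    rw [Complex.re_ofReal_mul, re_integral_exp_eq_fejerKernel]
  rw [hswap]
  simp_rw [hinner]
  change (∫ v in Set.Ioi (0 : ℝ), G v).re ≤ _
  have hcomm := Complex.reCLM.integral_comp_comm hGint
  simp only [Complex.reCLM_apply, hre] at hcomm
  rw [← hcomm]
  calc ∫ v in Set.Ioi (0 : ℝ), Real.exp (-σ * v) * fejerKernel T (v - U)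
      ≤ ∫ v in Set.Ioi (0 : ℝ), fejerKernel T (v - U) := by
        refine setIntegral_mono_on ?_ hKint.integrableOn measurableSet_Ioi fun v hv => ?_
        · exact hGint.re.congr (ae_of_all _ fun v => hre v)
        · refine mul_le_of_le_one_left (fejerKernel_nonneg hT _) (Real.exp_le_one_iff.2 ?_)
          have : 0 < v := hv
          nlinarith
    _ ≤ ∫ v, fejerKernel T (v - U) :=
        setIntegral_le_integral hKint (ae_of_all _ fun v => fejerKernel_nonneg hT _)
    _ = ∫ v, fejerKernel 1 v := by
        rw [integral_sub_right_eq_self, integral_fejerKernel hT]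

theorem sum_vonMangoldt_fejerKernel_le {T : ℝ} (hT : 0 < T) (U : ℝ) (s : Finset ℕ) :
    ∑ n ∈ s, vonMangoldt n / n * fejerKernel T (Real.log n - U) ≤
      (∫ t in -T..T, ((1 - |t| / T : ℝ) : ℂ) * Complex.exp ((t * U : ℝ) * Complex.I) *
        zetaRegularPart 0 t).re + ∫ v, fejerKernel 1 v := by
  have hcR : Continuous fun σ : ℝ => ∫ t in -T..T, ((1 - |t| / T : ℝ) : ℂ) *
      Complex.exp ((t * U : ℝ) * Complex.I) * zetaRegularPart σ t := by
    refine intervalIntegral.continuous_parametric_intervalIntegral_of_continuous' ?_ _ _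
    exact Continuous.mul (by fun_prop) continuous_zetaRegularPart
  have hR : Tendsto (fun σ : ℝ => (∫ t in -T..T, ((1 - |t| / T : ℝ) : ℂ) *
      Complex.exp ((t * U : ℝ) * Complex.I) * zetaRegularPart σ t).re + ∫ v, fejerKernel 1 v)
      (𝓝[>] 0) (𝓝 ((∫ t in -T..T, ((1 - |t| / T : ℝ) : ℂ) *
        Complex.exp ((t * U : ℝ) * Complex.I) * zetaRegularPart 0 t).re +
          ∫ v, fejerKernel 1 v)) :=
    (((Complex.continuous_re.comp hcR).tendsto 0).mono_left nhdsWithin_le_nhds).add_const _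
  have hL : Tendsto (fun σ : ℝ => ∑ n ∈ s, vonMangoldt n * (n : ℝ) ^ (-(1 + σ)) *
      fejerKernel T (Real.log n - U)) (𝓝[>] 0)
      (𝓝 (∑ n ∈ s, vonMangoldt n / n * fejerKernel T (Real.log n - U))) := by
    refine tendsto_finsetSum _ fun n _ => Tendsto.mul_const _ ?_
    rcases eq_or_ne n 0 with rfl | hn
    · simp
    have hpos : (0 : ℝ) < n := by exact_mod_cast hn.bot_lt
    have hc : Continuous fun σ : ℝ => vonMangoldt n * (n : ℝ) ^ (-(1 + σ)) :=
      continuous_const.mul (Continuous.rpow continuous_const (by fun_prop) fun _ => Or.inl hpos.ne')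
    have := (hc.tendsto 0).mono_left (nhdsWithin_le_nhds (s := Set.Ioi (0 : ℝ)))
    simpa [Real.rpow_neg_one, div_eq_mul_inv] using this
  refine le_of_tendsto_of_tendsto hL hR ?_
  filter_upwards [self_mem_nhdsWithin] with σ hσ
  have hσ : 0 < σ := hσ
  refine (sum_vonMangoldt_fejerKernel_le_LSeries hT hσ U s).trans ?_
  have hpoleInt : IntervalIntegrable (fun t : ℝ => ((1 - |t| / T : ℝ) : ℂ) *
      Complex.exp ((t * U : ℝ) * Complex.I) * (1 / (σ + t * Complex.I))) volume (-T) T := by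
    refine Continuous.intervalIntegrable (Continuous.mul (by fun_prop) ?_) _ _
    refine Continuous.div continuous_const (by fun_prop) fun t h => ?_
    have := congrArg Complex.re h
    simp at this
    exact hσ.ne' this
  have hsplit : (∫ t in -T..T, ((1 - |t| / T : ℝ) : ℂ) * Complex.exp ((t * U : ℝ) * Complex.I) *
        LSeries (fun n => (vonMangoldt n : ℂ)) (1 + σ + t * Complex.I)) =
      (∫ t in -T..T, ((1 - |t| / T : ℝ) : ℂ) * Complex.exp ((t * U : ℝ) * Complex.I) *
        zetaRegularPart σ t) + ∫ t in -T..T, ((1 - |t| / T : ℝ) : ℂ) *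
          Complex.exp ((t * U : ℝ) * Complex.I) * (1 / (σ + t * Complex.I)) := by
    rw [← intervalIntegral.integral_add _ hpoleInt]
    · refine intervalIntegral.integral_congr fun t _ => ?_
      simp only [zetaRegularPart_eq hσ]
      ring
    · exact Continuous.intervalIntegrable (Continuous.mul (by fun_prop)
        (continuous_zetaRegularPart.comp (f := fun t : ℝ => (σ, t)) (by fun_prop))) _ _
  rw [hsplit, Complex.add_re]
  exact add_le_add_right (re_integral_pole_le hT hσ U) _

end Tauberian

section PrimeWindows

open MeasureTheory

open ArithmeticFunction hiding log

theorem tendsto_re_integral_zetaRegularPart {T : ℝ} (hT : 0 < T) :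
    Tendsto (fun U : ℝ => (∫ t in -T..T, ((1 - |t| / T : ℝ) : ℂ) *
      Complex.exp ((t * U : ℝ) * Complex.I) * zetaRegularPart 0 t).re) atTop (𝓝 0) := by
  have h := Real.tendsto_integral_exp_smul_cocompact
    ((Set.Ioc (-T) T).indicator fun t : ℝ => ((1 - |t| / T : ℝ) : ℂ) * zetaRegularPart 0 t)
  have hU : Tendsto (fun U : ℝ => -(U / (2 * Real.pi))) atTop (cocompact ℝ) :=
    (tendsto_neg_atTop_atBot.comp (tendsto_id.atTop_div_const (by positivity))).mono_right
      atBot_le_cocompact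
  have h2 := (Complex.continuous_re.tendsto 0).comp (h.comp hU)
  rw [Complex.zero_re] at h2
  refine h2.congr fun U => ?_
  simp only [Function.comp]
  congr 1
  rw [intervalIntegral.integral_of_le (by linarith), ← integral_indicator measurableSet_Ioc]
  refine integral_congr_ae (ae_of_all _ fun t => ?_)
  simp only
  by_cases ht : t ∈ Set.Ioc (-T) T
  · rw [Set.indicator_of_mem ht, Set.indicator_of_mem ht, Circle.smul_def, Real.fourierChar_apply,
      smul_eq_mul]
    have : (2 * Real.pi * -(t * -(U / (2 * Real.pi))) : ℝ) = t * U := by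
      field_simp
    rw [this]
    ring
  · rw [Set.indicator_of_notMem ht, Set.indicator_of_notMem ht, smul_zero]

/-- The von Mangoldt function has logarithmic density at most `1` on multiplicative windows of
ratio `e`. -/
theorem eventually_sum_vonMangoldt_div_le {δ : ℝ} (hδ : 0 < δ) :
    ∀ᶠ U : ℝ in atTop, ∀ s : Finset ℕ, (∀ n ∈ s, U ≤ Real.log n ∧ Real.log n ≤ U + 1) →
      ∑ n ∈ s, vonMangoldt n / n ≤ 1 + δ := by
  wlog hδ' : δ ≤ 1 / 2 generalizing δ
  · filter_upwards [this (δ := 1 / 2) (by norm_num) le_rfl] with U hU s hs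
    linarith [hU s hs]
  set I := ∫ v, fejerKernel 1 v with hI
  have hIpos : 0 < I := integral_fejerKernel_one_pos
  set η := δ / 8 with hη
  have hηpos : 0 < η := by positivity
  obtain ⟨T, hTc, hT⟩ : ∃ T : ℝ, I * (1 - δ / 4) < ∫ v in -η..η, fejerKernel T v ∧ 0 < T :=
    (((tendsto_integral_fejerKernel hηpos).eventually_const_lt (u := I * (1 - δ / 4))
      (by nlinarith)).and (eventually_gt_atTop 0)).exists
  obtain ⟨U₀, hU₀⟩ := eventually_atTop.1
    ((tendsto_re_integral_zetaRegularPart hT).eventually_lt_const (u := I * (δ / 4))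
      (by positivity))
  filter_upwards [eventually_ge_atTop (U₀ + η)] with U hU s hs
  have hcont : ∀ x : ℝ, Continuous fun w => fejerKernel T (x - w) := fun x =>
    (continuous_fejerKernel T).comp (by fun_prop)
  have hupper : ∑ n ∈ s, vonMangoldt n / n *
      ∫ w in (U - η)..(U + 1 + η), fejerKernel T (Real.log n - w) ≤
        (1 + 2 * η) * (I * (1 + δ / 4)) := by
    calc _ = ∫ w in (U - η)..(U + 1 + η),
          ∑ n ∈ s, vonMangoldt n / n * fejerKernel T (Real.log n - w) := by
          rw [intervalIntegral.integral_finsetSum fun n _ =>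
            ((hcont _).const_mul _).intervalIntegrable _ _]
          simp_rw [intervalIntegral.integral_const_mul]
      _ ≤ ∫ w in (U - η)..(U + 1 + η), I * (1 + δ / 4) := by
          refine intervalIntegral.integral_mono_on (by linarith) ?_ (by simp) fun w hw => ?_
          · exact (continuous_finsetSum _ fun n _ => (hcont _).const_mul _).intervalIntegrable _ _
          · refine (sum_vonMangoldt_fejerKernel_le hT w s).trans ?_
            have := hU₀ w (by linarith [hw.1])
            rw [← hI]
            linarith
      _ = _ := by
          rw [intervalIntegral.integral_const, smul_eq_mul]
          ring
  have hlower : ∀ n ∈ s, I * (1 - δ / 4) ≤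
      ∫ w in (U - η)..(U + 1 + η), fejerKernel T (Real.log n - w) := by
    intro n hn
    refine hTc.le.trans ?_
    have hsub : ∫ v in -η..η, fejerKernel T v =
        ∫ w in (Real.log n - η)..(Real.log n + η), fejerKernel T (Real.log n - w) := by
      rw [intervalIntegral.integral_comp_sub_left (fejerKernel T)]
      congr 1 <;> ring
    rw [hsub]
    exact intervalIntegral.integral_mono_interval (by linarith [(hs n hn).1]) (by linarith)
      (by linarith [(hs n hn).2]) (ae_of_all _ fun w => fejerKernel_nonneg hT _)
      ((hcont _).intervalIntegrable _ _)
  have hmain : (∑ n ∈ s, vonMangoldt n / n) * (I * (1 - δ / 4)) ≤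
      (1 + 2 * η) * (I * (1 + δ / 4)) := by
    refine le_trans ?_ hupper
    rw [Finset.sum_mul]
    exact Finset.sum_le_sum fun n hn => mul_le_mul_of_nonneg_left (hlower n hn)
      (div_nonneg vonMangoldt_nonneg n.cast_nonneg)
  have hpos : 0 < 1 - δ / 4 := by linarith
  have h1 : (∑ n ∈ s, vonMangoldt n / n) * (1 - δ / 4) ≤ (1 + 2 * η) * (1 + δ / 4) := by
    refine le_of_mul_le_mul_right ?_ hIpos
    linarith
  refine le_of_mul_le_mul_right (h1.trans ?_) hpos
  rw [hη]
  nlinarith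

/-- Sharp upper bound for sums of reciprocals of primes in `(x, e x]`. -/
theorem eventually_sum_one_div_prime_le {δ : ℝ} (hδ : 0 < δ) :
    ∀ᶠ x : ℝ in atTop, ∀ s : Finset ℕ,
      (∀ p ∈ s, p.Prime ∧ x < p ∧ (p : ℝ) ≤ Real.exp 1 * x) →
        ∑ p ∈ s, 1 / (p : ℝ) ≤ (1 + δ) / Real.log x := by
  filter_upwards [Real.tendsto_log_atTop.eventually (eventually_sum_vonMangoldt_div_le hδ),
    eventually_gt_atTop 1] with x hx hx1 s hs
  have hlog : 0 < Real.log x := Real.log_pos hx1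
  have hx0 : 0 < x := by linarith
  rw [le_div_iff₀ hlog, Finset.sum_mul]
  refine le_trans (Finset.sum_le_sum fun p hp => ?_) (hx s fun p hp => ⟨?_, ?_⟩)
  · obtain ⟨hpp, h1, h2⟩ := hs p hp
    rw [vonMangoldt_apply_prime hpp, one_div_mul_eq_div]
    exact div_le_div_of_nonneg_right (Real.log_le_log hx0 h1.le) p.cast_nonneg
  · exact Real.log_le_log hx0 (hs p hp).2.1.le
  · obtain ⟨hpp, h1, h2⟩ := hs p hp
    refine (Real.log_le_log (by linarith) h2).trans_eq ?_
    rw [Real.log_mul (Real.exp_pos 1).ne' hx0.ne', Real.log_exp]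
    ring

end PrimeWindows

section QuadraticIdeals

open UniqueFactorizationMonoid Module

theorem IsQSqrtNeg.finrank_le_two {D : ℕ} {K : Type*} [Field K] [NumberField K]
    (h : IsQSqrtNeg D K) : finrank ℚ K ≤ 2 := by
  obtain ⟨x, hx, htop⟩ := h
  have hroot : Polynomial.aeval x (Polynomial.X ^ 2 + Polynomial.C (D : ℚ)) = 0 := by
    simp [hx]
  have hmonic : (Polynomial.X ^ 2 + Polynomial.C (D : ℚ)).Monic :=
    Polynomial.monic_X_pow_add_C _ two_ne_zero
  have hint : IsIntegral ℚ x := ⟨_, hmonic, hroot⟩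
  rw [← IntermediateField.finrank_top', ← htop, IntermediateField.adjoin.finrank hint]
  refine (Polynomial.natDegree_le_natDegree (minpoly.min ℚ x hmonic hroot)).trans ?_
  rw [Polynomial.natDegree_X_pow_add_C]

section

variable {K : Type*} [Field K]

theorem primeBelow_prime {𝔭 : Ideal (𝓞 K)} (h : 𝔭.IsPrime) (h0 : 𝔭 ≠ ⊥) :
    (primeBelow 𝔭).Prime := by
  have : NeZero 𝔭 := ⟨h0⟩
  exact Nat.absNorm_under_prime 𝔭

theorem prod_ne_bot_of_isPrime {S : Finset (Ideal (𝓞 K))}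
    (hS : ∀ 𝔭 ∈ S, 𝔭.IsPrime ∧ 𝔭 ≠ ⊥) : ∏ 𝔭 ∈ S, 𝔭 ≠ ⊥ :=
  Finset.prod_ne_zero_iff.2 fun 𝔭 h𝔭 => (hS 𝔭 h𝔭).2

variable [NumberField K]

theorem absNorm_pos {I : Ideal (𝓞 K)} (h0 : I ≠ ⊥) : 0 < Ideal.absNorm I :=
  Nat.pos_of_ne_zero fun h => h0 (Ideal.absNorm_eq_zero_iff.1 h)

theorem primeBelow_le_absNorm {𝔭 : Ideal (𝓞 K)} (h0 : 𝔭 ≠ ⊥) :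
    primeBelow 𝔭 ≤ Ideal.absNorm 𝔭 :=
  Nat.le_of_dvd (absNorm_pos h0) (Int.absNorm_under_dvd_absNorm 𝔭)

theorem dvd_span_primeBelow (𝔭 : Ideal (𝓞 K)) :
    𝔭 ∣ Ideal.span {((primeBelow 𝔭 : ℕ) : 𝓞 K)} := by
  rw [Ideal.dvd_span_singleton]
  exact Int.absNorm_under_mem 𝔭

theorem absNorm_span_natCast (p : ℕ) :
    Ideal.absNorm (Ideal.span {(p : 𝓞 K)}) = p ^ finrank ℚ K := by
  rw [Ideal.absNorm_span_natCast, RingOfIntegers.rank]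

theorem absNorm_le_primeBelow_sq (hK : finrank ℚ K ≤ 2) {𝔭 : Ideal (𝓞 K)} (h : 𝔭.IsPrime)
    (h0 : 𝔭 ≠ ⊥) : Ideal.absNorm 𝔭 ≤ primeBelow 𝔭 ^ 2 := by
  have hp := (primeBelow_prime h h0).pos
  have hdvd := map_dvd Ideal.absNorm (dvd_span_primeBelow 𝔭)
  rw [absNorm_span_natCast] at hdvd
  exact (Nat.le_of_dvd (by positivity) hdvd).trans (Nat.pow_le_pow_right hp hK)

theorem card_primes_over_le (hK : finrank ℚ K ≤ 2) (S : Finset (Ideal (𝓞 K))) {p : ℕ}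
    (hS : ∀ 𝔭 ∈ S, 𝔭.IsPrime ∧ 𝔭 ≠ ⊥ ∧ primeBelow 𝔭 = p) : S.card ≤ 2 := by
  rcases S.eq_empty_or_nonempty with rfl | ⟨𝔮, h𝔮⟩
  · simp
  have hp : p.Prime := (hS 𝔮 h𝔮).2.2 ▸ primeBelow_prime (hS 𝔮 h𝔮).1 (hS 𝔮 h𝔮).2.1
  have hdvd : ∏ 𝔭 ∈ S, 𝔭 ∣ Ideal.span {(p : 𝓞 K)} := by
    refine Finset.prod_primes_dvd _ (fun 𝔭 h𝔭 => ?_) fun 𝔭 h𝔭 => ?_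
    · exact Ideal.prime_of_isPrime (hS 𝔭 h𝔭).2.1 (hS 𝔭 h𝔭).1
    · exact (hS 𝔭 h𝔭).2.2 ▸ dvd_span_primeBelow 𝔭
  have hN := map_dvd Ideal.absNorm hdvd
  rw [absNorm_span_natCast, map_prod] at hN
  have hle := Nat.le_of_dvd (pow_pos hp.pos _) hN
  have hge : p ^ S.card ≤ ∏ 𝔭 ∈ S, Ideal.absNorm 𝔭 :=
    Finset.pow_card_le_prod _ _ _ fun 𝔭 h𝔭 =>
      (hS 𝔭 h𝔭).2.2 ▸ primeBelow_le_absNorm (hS 𝔭 h𝔭).2.1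
  exact ((Nat.pow_le_pow_iff_right hp.one_lt).1 (hge.trans hle)).trans hK

theorem sum_comp_primeBelow_le (hK : finrank ℚ K ≤ 2) (S : Finset (Ideal (𝓞 K)))
    (hS : ∀ 𝔭 ∈ S, 𝔭.IsPrime ∧ 𝔭 ≠ ⊥) {φ : ℕ → ℝ} (hφ : ∀ n, 0 ≤ φ n) :
    ∑ 𝔭 ∈ S, φ (primeBelow 𝔭) ≤ 2 * ∑ p ∈ S.image primeBelow, φ p := by
  rw [Finset.sum_comp φ primeBelow, Finset.mul_sum]
  refine Finset.sum_le_sum fun p _ => ?_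
  rw [nsmul_eq_mul]
  refine mul_le_mul_of_nonneg_right ?_ (hφ p)
  have := card_primes_over_le hK (S.filter fun 𝔭 => primeBelow 𝔭 = p) (p := p) fun 𝔭 h𝔭 => by
    rw [Finset.mem_filter] at h𝔭
    exact ⟨(hS 𝔭 h𝔭.1).1, (hS 𝔭 h𝔭.1).2, h𝔭.2⟩
  exact_mod_cast this

theorem normalizedFactors_prod_of_isPrime {S : Finset (Ideal (𝓞 K))}
    (hS : ∀ 𝔭 ∈ S, 𝔭.IsPrime ∧ 𝔭 ≠ ⊥) : normalizedFactors (∏ 𝔭 ∈ S, 𝔭) = S.val := by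
  have h := normalizedFactors_prod_of_prime (m := S.val) fun 𝔭 h𝔭 =>
    Ideal.prime_of_isPrime (hS 𝔭 h𝔭).2 (hS 𝔭 h𝔭).1
  rwa [Finset.prod_val] at h

theorem primeFactors_prod_of_isPrime {S : Finset (Ideal (𝓞 K))}
    (hS : ∀ 𝔭 ∈ S, 𝔭.IsPrime ∧ 𝔭 ≠ ⊥) : primeFactors (∏ 𝔭 ∈ S, 𝔭) = S := by
  ext 𝔭
  rw [mem_primeFactors, normalizedFactors_prod_of_isPrime hS, Finset.mem_val]

theorem squarefree_prod_of_isPrime {S : Finset (Ideal (𝓞 K))}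
    (hS : ∀ 𝔭 ∈ S, 𝔭.IsPrime ∧ 𝔭 ≠ ⊥) : Squarefree (∏ 𝔭 ∈ S, 𝔭) := by
  rw [squarefree_iff_nodup_normalizedFactors (prod_ne_bot_of_isPrime hS),
    normalizedFactors_prod_of_isPrime hS]
  exact S.nodup

theorem prod_primeFactors_of_squarefree {𝔫 : Ideal (𝓞 K)} (h : Squarefree 𝔫) :
    ∏ 𝔭 ∈ primeFactors 𝔫, 𝔭 = 𝔫 := by
  have hval := Finset.prod_val (primeFactors 𝔫)
  rw [primeFactors_val_eq_normalizedFactors h.isRadical] at hval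
  exact hval.symm.trans <| Ideal.prod_normalizedFactors_eq_self h.ne_zero

theorem prod_dvd_prod_iff_subset {R S : Finset (Ideal (𝓞 K))}
    (hR : ∀ 𝔭 ∈ R, 𝔭.IsPrime ∧ 𝔭 ≠ ⊥) (hS : ∀ 𝔭 ∈ S, 𝔭.IsPrime ∧ 𝔭 ≠ ⊥) :
    ∏ 𝔭 ∈ R, 𝔭 ∣ ∏ 𝔭 ∈ S, 𝔭 ↔ R ⊆ S := by
  rw [dvd_iff_normalizedFactors_le_normalizedFactors (prod_ne_bot_of_isPrime hR)
    (prod_ne_bot_of_isPrime hS), normalizedFactors_prod_of_isPrime hR,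
    normalizedFactors_prod_of_isPrime hS, Finset.val_le_iff]

end

end QuadraticIdeals

section Combinatorics

open Finset

variable {ι : Type*}

theorem prod_one_add_le_exp_sum (P : Finset ι) {w : ι → ℝ} (hw : ∀ i ∈ P, 0 ≤ w i) :
    ∏ i ∈ P, (1 + w i) ≤ Real.exp (∑ i ∈ P, w i) := by
  rw [Real.exp_sum]
  refine Finset.prod_le_prod (fun i hi => by linarith [hw i hi]) fun i _ => ?_
  linarith [Real.add_one_le_exp (w i)]

theorem exp_le_prod_one_add_div (P : Finset ι) {u v : ι → ℝ} (hu : ∀ i ∈ P, 0 ≤ u i)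
    (hv : ∀ i ∈ P, 0 ≤ v i) {ε : ℝ} (huε : ∀ i ∈ P, u i ≤ ε) (hvε : ∀ i ∈ P, v i ≤ ε) :
    Real.exp ((1 - 2 * ε) * ∑ i ∈ P, v i) * ∏ i ∈ P, (1 + u i) ≤
      ∏ i ∈ P, (1 + (u i + v i)) := by
  rw [Finset.mul_sum, Real.exp_sum, ← Finset.prod_mul_distrib]
  refine Finset.prod_le_prod (fun i hi => ?_) fun i hi => ?_
  · exact mul_nonneg (Real.exp_pos _).le (by linarith [hu i hi])
  have h0 := hu i hi
  have h1 := hv i hi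
  have h2 := huε i hi
  have h3 := hvε i hi
  have hpos : 0 < 1 + u i := by linarith
  rw [← le_div_iff₀ hpos, ← Real.le_log_iff_exp_le (by positivity)]
  refine le_trans ?_ (Real.one_sub_inv_le_log_of_pos (by positivity))
  have hpos2 : 0 < 1 + (u i + v i) := by linarith
  rw [inv_div]
  have : 1 - (1 + u i) / (1 + (u i + v i)) = v i / (1 + (u i + v i)) := by
    field_simp
    ring
  rw [this, le_div_iff₀ hpos2]
  have h4 : (1 - 2 * ε) * (1 + (u i + v i)) ≤ 1 := by nlinarith
  nlinarith

/-- Rankin's bound for the weight of the subsets with many elements satisfying `q`. -/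
theorem sum_powerset_filter_card_le (P : Finset ι) {w : ι → ℝ} (hw : ∀ i ∈ P, 0 ≤ w i)
    (q : ι → Prop) [DecidablePred q] {b : ℝ} (hb : 1 ≤ b) (T : ℝ) :
    ∑ S ∈ P.powerset with T ≤ ((S.filter q).card : ℝ), ∏ i ∈ S, w i ≤
      Real.exp (-(T * Real.log b) + (b - 1) * ∑ i ∈ P with q i, w i) *
        ∏ i ∈ P, (1 + w i) := by
  have hb0 : 0 < b := by linarith
  have hlog : 0 ≤ Real.log b := Real.log_nonneg hb
  have hb1 : ∀ i, 0 ≤ if q i then b else 1 := fun i => by split_ifs <;> linarith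
  calc ∑ S ∈ P.powerset with T ≤ ((S.filter q).card : ℝ), ∏ i ∈ S, w i
      ≤ ∑ S ∈ P.powerset with T ≤ ((S.filter q).card : ℝ),
          Real.exp (-(T * Real.log b)) * ∏ i ∈ S, ((if q i then b else 1) * w i) := by
        refine Finset.sum_le_sum fun S hS => ?_
        rw [Finset.mem_filter, Finset.mem_powerset] at hS
        rw [Finset.prod_mul_distrib, ← mul_assoc]
        refine le_mul_of_one_le_left (Finset.prod_nonneg fun i hi => hw i (hS.1 hi)) ?_
        have : ∏ i ∈ S, (if q i then b else 1) =
            Real.exp (((S.filter q).card : ℝ) * Real.log b) := by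
          rw [Finset.prod_ite, Finset.prod_const, Finset.prod_const_one, mul_one,
            Real.exp_nat_mul, Real.exp_log hb0]
        rw [this, ← Real.exp_add]
        exact Real.one_le_exp (by nlinarith [hS.2])
    _ ≤ ∑ S ∈ P.powerset,
          Real.exp (-(T * Real.log b)) * ∏ i ∈ S, ((if q i then b else 1) * w i) := by
        refine Finset.sum_le_sum_of_subset_of_nonneg (Finset.filter_subset _ _) fun S hS _ => ?_
        rw [Finset.mem_powerset] at hS
        exact mul_nonneg (Real.exp_pos _).le
          (Finset.prod_nonneg fun i hi => mul_nonneg (hb1 i) (hw i (hS hi)))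
    _ = Real.exp (-(T * Real.log b)) * ∏ i ∈ P, (1 + (if q i then b else 1) * w i) := by
        rw [← Finset.mul_sum, Finset.prod_one_add]
    _ ≤ Real.exp (-(T * Real.log b)) *
          ∏ i ∈ P, ((1 + if q i then (b - 1) * w i else 0) * (1 + w i)) := by
        refine mul_le_mul_of_nonneg_left (Finset.prod_le_prod (fun i hi => ?_) fun i hi => ?_)
          (Real.exp_pos _).le
        · have := mul_nonneg (hb1 i) (hw i hi)
          linarith
        · have := hw i hi
          split_ifs <;> nlinarith [mul_nonneg (sub_nonneg.2 hb) (mul_nonneg this this)]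
    _ ≤ _ := by
        rw [Finset.prod_mul_distrib, Real.exp_add, mul_assoc]
        refine mul_le_mul_of_nonneg_left ?_ (Real.exp_pos _).le
        refine mul_le_mul_of_nonneg_right ?_ (Finset.prod_nonneg fun i hi => by linarith [hw i hi])
        refine (prod_one_add_le_exp_sum P fun i hi => ?_).trans_eq ?_
        · split_ifs
          · exact mul_nonneg (by linarith) (hw i hi)
          · exact le_rfl
        · rw [← Finset.sum_filter, Finset.mul_sum]

/-- Rankin's bound for the number of subsets with few elements in each class. -/
theorem card_filter_powerset_le (P : Finset ι) (J : Finset ℕ) (q : ℕ → ι → Prop)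
    [∀ k, DecidablePred (q k)] (hq : ∀ i ∈ P, ∃ k ∈ J, q k i) (T : ℕ → ℝ) {z : ℕ → ℝ}
    (hz : ∀ k ∈ J, 0 < z k) (hz1 : ∀ k ∈ J, z k ≤ 1) :
    ((P.powerset.filter fun S => ∀ k ∈ J, ((S.filter (q k)).card : ℝ) < T k).card : ℝ) ≤
      Real.exp (∑ k ∈ J, (T k * -Real.log (z k) + ((P.filter (q k)).card : ℝ) * z k)) := by
  set y : ι → ℝ := fun i => ∏ k ∈ J, if q k i then z k else 1 with hy
  have hy0 : ∀ i, 0 ≤ y i := fun i => Finset.prod_nonneg fun k hk => by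
    split_ifs
    · exact (hz k hk).le
    · exact zero_le_one
  have hyS : ∀ S : Finset ι, ∏ i ∈ S, y i =
      Real.exp (∑ k ∈ J, ((S.filter (q k)).card : ℝ) * Real.log (z k)) := fun S => by
    rw [hy, Finset.prod_comm, Real.exp_sum]
    refine Finset.prod_congr rfl fun k hk => ?_
    rw [Finset.prod_ite, Finset.prod_const, Finset.prod_const_one, mul_one, Real.exp_nat_mul,
      Real.exp_log (hz k hk)]
  have hyle : ∀ i ∈ P, y i ≤ ∑ k ∈ J, if q k i then z k else 0 := fun i hi => by
    obtain ⟨k, hk, hqk⟩ := hq i hi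
    have h1 : y i ≤ z k := by
      rw [hy]
      simp only
      rw [← Finset.mul_prod_erase _ _ hk, if_pos hqk]
      refine mul_le_of_le_one_right (hz k hk).le (Finset.prod_le_one (fun l hl => ?_) fun l hl => ?_)
      · split_ifs
        · exact (hz l (Finset.mem_of_mem_erase hl)).le
        · exact zero_le_one
      · split_ifs
        · exact hz1 l (Finset.mem_of_mem_erase hl)
        · exact le_rfl
    have h2 : (if q k i then z k else 0) ≤ ∑ k ∈ J, if q k i then z k else 0 :=
      Finset.single_le_sum (f := fun k => if q k i then z k else 0) (fun l hl => by
        split_ifs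
        · exact (hz l hl).le
        · exact le_rfl) hk
    rw [if_pos hqk] at h2
    exact h1.trans h2
  have hsumy : ∑ i ∈ P, y i ≤ ∑ k ∈ J, ((P.filter (q k)).card : ℝ) * z k := by
    refine (Finset.sum_le_sum hyle).trans_eq ?_
    rw [Finset.sum_comm]
    refine Finset.sum_congr rfl fun k _ => ?_
    rw [← Finset.sum_filter, Finset.sum_const, nsmul_eq_mul]
  rw [Finset.card_eq_sum_ones, Nat.cast_sum, Nat.cast_one]
  calc ∑ S ∈ P.powerset with ∀ k ∈ J, ((S.filter (q k)).card : ℝ) < T k, (1 : ℝ)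
      ≤ ∑ S ∈ P.powerset with ∀ k ∈ J, ((S.filter (q k)).card : ℝ) < T k,
          Real.exp (∑ k ∈ J, T k * -Real.log (z k)) * ∏ i ∈ S, y i := by
        refine Finset.sum_le_sum fun S hS => ?_
        rw [Finset.mem_filter] at hS
        rw [hyS, ← Real.exp_add, ← Finset.sum_add_distrib]
        refine Real.one_le_exp (Finset.sum_nonneg fun k hk => ?_)
        nlinarith [hS.2 k hk, Real.log_nonpos (hz k hk).le (hz1 k hk)]
    _ ≤ ∑ S ∈ P.powerset, Real.exp (∑ k ∈ J, T k * -Real.log (z k)) * ∏ i ∈ S, y i :=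
        Finset.sum_le_sum_of_subset_of_nonneg (Finset.filter_subset _ _) fun S _ _ =>
          mul_nonneg (Real.exp_pos _).le (Finset.prod_nonneg fun i _ => hy0 i)
    _ = Real.exp (∑ k ∈ J, T k * -Real.log (z k)) * ∏ i ∈ P, (1 + y i) := by
        rw [← Finset.mul_sum, Finset.prod_one_add]
    _ ≤ Real.exp (∑ k ∈ J, T k * -Real.log (z k)) *
          Real.exp (∑ k ∈ J, ((P.filter (q k)).card : ℝ) * z k) :=
        mul_le_mul_of_nonneg_left ((prod_one_add_le_exp_sum P fun i _ => hy0 i).trans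
          (Real.exp_le_exp.2 hsumy)) (Real.exp_pos _).le
    _ = _ := by rw [← Real.exp_add, ← Finset.sum_add_distrib]

variable [DecidableEq ι]

theorem sum_powerset_sum_powerset_prod (P : Finset ι) (u v : ι → ℝ) :
    ∑ S ∈ P.powerset, ∑ R ∈ S.powerset, (∏ i ∈ R, u i) * ∏ i ∈ S \ R, v i =
      ∏ i ∈ P, (1 + (u i + v i)) := by
  rw [Finset.prod_one_add]
  exact Finset.sum_congr rfl fun S _ => (Finset.prod_add u v S).symm

/-- Rankin's bound for the weight of the pairs `R ⊆ S` with large quotient norm. -/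
theorem sum_powerset_sum_filter_norm_le (P : Finset ι) {u v N : ι → ℝ} (hu : ∀ i ∈ P, 0 ≤ u i)
    (hv : ∀ i ∈ P, 0 ≤ v i) (hN : ∀ i ∈ P, 0 < N i) {X : ℝ} (hX : 0 < X) {α : ℝ} (hα : 0 ≤ α) :
    ∑ S ∈ P.powerset, ∑ R ∈ S.powerset with X ≤ ∏ i ∈ S \ R, N i,
        (∏ i ∈ R, u i) * ∏ i ∈ S \ R, v i ≤
      Real.exp (-(α * Real.log X) + ∑ i ∈ P, v i * N i ^ α) * ∏ i ∈ P, (1 + (u i + v i)) := by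
  have hvN : ∀ i ∈ P, 0 ≤ v i * N i ^ α := fun i hi =>
    mul_nonneg (hv i hi) (Real.rpow_nonneg (hN i hi).le _)
  calc _ ≤ ∑ S ∈ P.powerset, ∑ R ∈ S.powerset,
          Real.exp (-(α * Real.log X)) * ((∏ i ∈ R, u i) * ∏ i ∈ S \ R, (v i * N i ^ α)) := by
        refine Finset.sum_le_sum fun S hS => ?_
        rw [Finset.mem_powerset] at hS
        refine (Finset.sum_le_sum fun R hR => ?_).trans
          (Finset.sum_le_sum_of_subset_of_nonneg (Finset.filter_subset _ _) fun R hR _ => ?_)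
        · rw [Finset.mem_filter, Finset.mem_powerset] at hR
          have hsub : S \ R ⊆ P := Finset.sdiff_subset.trans hS
          have h0 : 0 ≤ (∏ i ∈ R, u i) * ∏ i ∈ S \ R, v i :=
            mul_nonneg (Finset.prod_nonneg fun i hi => hu i (hS (hR.1 hi)))
              (Finset.prod_nonneg fun i hi => hv i (hsub hi))
          have hprod : ∏ i ∈ S \ R, N i ^ α = (∏ i ∈ S \ R, N i) ^ α :=
            Real.finsetProd_rpow _ _ (fun i hi => (hN i (hsub hi)).le) _
          have h1 : 1 ≤ Real.exp (-(α * Real.log X)) * (∏ i ∈ S \ R, N i) ^ α := by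
            have : X ^ α ≤ (∏ i ∈ S \ R, N i) ^ α := Real.rpow_le_rpow hX.le hR.2 hα
            refine le_trans (le_of_eq ?_) (mul_le_mul_of_nonneg_left this (Real.exp_pos _).le)
            rw [Real.rpow_def_of_pos hX, ← Real.exp_add, eq_comm, Real.exp_eq_one_iff]
            ring
          rw [Finset.prod_mul_distrib, hprod]
          calc _ ≤ (Real.exp (-(α * Real.log X)) * (∏ i ∈ S \ R, N i) ^ α) *
                ((∏ i ∈ R, u i) * ∏ i ∈ S \ R, v i) := le_mul_of_one_le_left h0 h1
            _ = _ := by ring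
        · rw [Finset.mem_powerset] at hR
          have hsub : S \ R ⊆ P := Finset.sdiff_subset.trans hS
          exact mul_nonneg (Real.exp_pos _).le
            (mul_nonneg (Finset.prod_nonneg fun i hi => hu i (hS (hR hi)))
              (Finset.prod_nonneg fun i hi => hvN i (hsub hi)))
    _ = Real.exp (-(α * Real.log X)) * ∏ i ∈ P, (1 + (u i + v i * N i ^ α)) := by
        simp_rw [← Finset.mul_sum]
        rw [sum_powerset_sum_powerset_prod]
    _ ≤ Real.exp (-(α * Real.log X)) *
          ∏ i ∈ P, ((1 + v i * N i ^ α) * (1 + (u i + v i))) := by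
        refine mul_le_mul_of_nonneg_left (Finset.prod_le_prod (fun i hi => ?_) fun i hi => ?_)
          (Real.exp_pos _).le
        · linarith [hvN i hi, hu i hi]
        · nlinarith [hvN i hi, hu i hi, hv i hi, mul_nonneg (hvN i hi) (hu i hi),
            mul_nonneg (hvN i hi) (hv i hi)]
    _ ≤ _ := by
        rw [Finset.prod_mul_distrib, Real.exp_add, mul_assoc]
        refine mul_le_mul_of_nonneg_left ?_ (Real.exp_pos _).le
        refine mul_le_mul_of_nonneg_right ?_
          (Finset.prod_nonneg fun i hi => by linarith [hu i hi, hv i hi])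
        exact prod_one_add_le_exp_sum P hvN

/-- The truncated pair sum is bounded below by the full Euler product up to the Rankin errors. -/
theorem prod_mul_one_sub_le_sum (P : Finset ι) {u v N : ι → ℝ} (hu : ∀ i ∈ P, 0 ≤ u i)
    (hv : ∀ i ∈ P, 0 ≤ v i) (hN : ∀ i ∈ P, 0 < N i) {X : ℝ} (hX : 0 < X) {α : ℝ} (hα : 0 ≤ α)
    (J : Finset ℕ) (q : ℕ → ι → Prop) [∀ k, DecidablePred (q k)] (T : ℕ → ℝ) {b : ℝ}
    (hb : 1 ≤ b) :
    (∏ i ∈ P, (1 + (u i + v i))) *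
        (1 - ∑ k ∈ J, Real.exp (-(T k * Real.log b) + (b - 1) * ∑ i ∈ P with q k i, (u i + v i)) -
          Real.exp (-(α * Real.log X) + ∑ i ∈ P, v i * N i ^ α)) ≤
      ∑ S ∈ P.powerset with ∀ k ∈ J, ((S.filter (q k)).card : ℝ) < T k,
        ∑ R ∈ S.powerset with ∏ i ∈ S \ R, N i < X, (∏ i ∈ R, u i) * ∏ i ∈ S \ R, v i := by
  set W : Finset ι → Finset ι → ℝ := fun S R => (∏ i ∈ R, u i) * ∏ i ∈ S \ R, v i with hW
  have hW0 : ∀ S ∈ P.powerset, ∀ R ∈ S.powerset, 0 ≤ W S R := fun S hS R hR => by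
    rw [Finset.mem_powerset] at hS hR
    exact mul_nonneg (Finset.prod_nonneg fun i hi => hu i (hS (hR hi)))
      (Finset.prod_nonneg fun i hi => hv i (hS (Finset.sdiff_subset hi)))
  have hWS : ∀ S, ∑ R ∈ S.powerset, W S R = ∏ i ∈ S, (u i + v i) := fun S =>
    (Finset.prod_add u v S).symm
  have hfull := sum_powerset_sum_powerset_prod P u v
  have hbad := fun k => sum_powerset_filter_card_le P (w := fun i => u i + v i)
    (fun i hi => add_nonneg (hu i hi) (hv i hi)) (q k) hb (T k)
  have hlarge := sum_powerset_sum_filter_norm_le P hu hv hN hX hα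
  have hpoint : ∀ S ∈ P.powerset, ∑ R ∈ S.powerset, W S R ≤
      (if ∀ k ∈ J, ((S.filter (q k)).card : ℝ) < T k then
        ∑ R ∈ S.powerset with ∏ i ∈ S \ R, N i < X, W S R else 0) +
      ∑ k ∈ J, (if T k ≤ ((S.filter (q k)).card : ℝ) then ∏ i ∈ S, (u i + v i) else 0) +
      ∑ R ∈ S.powerset with X ≤ ∏ i ∈ S \ R, N i, W S R := by
    intro S hS
    have hprod : 0 ≤ ∏ i ∈ S, (u i + v i) := by
      rw [← hWS]
      exact Finset.sum_nonneg (hW0 S hS)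
    have hbad0 : ∀ k ∈ J, 0 ≤
        (if T k ≤ ((S.filter (q k)).card : ℝ) then ∏ i ∈ S, (u i + v i) else 0) := fun k _ => by
      split_ifs
      · exact hprod
      · exact le_rfl
    split_ifs with hgood
    · have hsplit := Finset.sum_filter_add_sum_filter_not S.powerset
        (fun R => ∏ i ∈ S \ R, N i < X) (W S)
      simp only [not_lt] at hsplit
      linarith [Finset.sum_nonneg hbad0]
    · push Not at hgood
      obtain ⟨k, hk, hTk⟩ := hgood
      have h1 := Finset.single_le_sum hbad0 hk
      rw [if_pos hTk] at h1
      have h2 : 0 ≤ ∑ R ∈ S.powerset with X ≤ ∏ i ∈ S \ R, N i, W S R :=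
        Finset.sum_nonneg fun R hR => hW0 S hS R (Finset.mem_filter.1 hR).1
      rw [hWS]
      linarith
  have hsum := Finset.sum_le_sum hpoint
  rw [Finset.sum_add_distrib, Finset.sum_add_distrib, ← Finset.sum_filter, Finset.sum_comm (t := J),
    hfull] at hsum
  simp_rw [← Finset.sum_filter] at hsum
  have hbads := Finset.sum_le_sum fun k (_ : k ∈ J) => hbad k
  rw [← Finset.sum_mul] at hbads
  linarith

end Combinatorics

section Translation

open UniqueFactorizationMonoid
open scoped Classical

variable (K : Type*) [Field K] [NumberField K]

/-- The finite set of prime ideals `ℙ`. -/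
def primeFinset (γ : ℝ) (M : ℕ) : Finset (Ideal (𝓞 K)) := (resonatorPrimes_finite K γ M).toFinset

/-- The sets of prime ideals in `ℙ` whose products form `𝓜`. -/
def goodSets (γ a : ℝ) (M : ℕ) : Finset (Finset (Ideal (𝓞 K))) :=
  (primeFinset K γ M).powerset.filter fun S => ∀ k ∈ Finset.Icc 1 (shellCount γ M - 1),
    ((S.filter (· ∈ shellPrimes K M k)).card : ℝ) < a * iterLog 1 M / ((k : ℝ) ^ 2 * iterLog 3 M)

/-- The value `f(𝔭)` at the prime ideals of `ℙ`. -/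
def primeValue {K : Type*} [Field K] (M : ℕ) (𝔭 : Ideal (𝓞 K)) : ℝ := amplitude M * primeWeight M 𝔭

variable {K} {γ a : ℝ} {M D : ℕ}

theorem mem_primeFinset {𝔭 : Ideal (𝓞 K)} :
    𝔭 ∈ primeFinset K γ M ↔ ∃ k ∈ Finset.Icc 1 (shellCount γ M - 1), 𝔭 ∈ shellPrimes K M k := by
  simp [primeFinset, resonatorPrimes]

theorem isPrime_of_mem_primeFinset {𝔭 : Ideal (𝓞 K)} (h : 𝔭 ∈ primeFinset K γ M) :
    𝔭.IsPrime ∧ 𝔭 ≠ ⊥ := by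
  obtain ⟨k, -, hk⟩ := mem_primeFinset.1 h
  exact ⟨hk.1, hk.2.1⟩

theorem isPrime_of_subset_primeFinset {S : Finset (Ideal (𝓞 K))} (hS : S ⊆ primeFinset K γ M) :
    ∀ 𝔭 ∈ S, 𝔭.IsPrime ∧ 𝔭 ≠ ⊥ := fun _ h => isPrime_of_mem_primeFinset (hS h)

theorem subset_primeFinset_of_mem_goodSets {S : Finset (Ideal (𝓞 K))} (hS : S ∈ goodSets K γ a M) :
    S ⊆ primeFinset K γ M := Finset.mem_powerset.1 (Finset.mem_filter.1 hS).1

theorem goodSets_mono {R S : Finset (Ideal (𝓞 K))} (hS : S ∈ goodSets K γ a M) (hRS : R ⊆ S) :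
    R ∈ goodSets K γ a M := by
  refine Finset.mem_filter.2
    ⟨Finset.mem_powerset.2 (hRS.trans (subset_primeFinset_of_mem_goodSets hS)), fun k hk => ?_⟩
  refine lt_of_le_of_lt ?_ ((Finset.mem_filter.1 hS).2 k hk)
  exact_mod_cast Finset.card_le_card (Finset.filter_subset_filter _ hRS)

theorem prod_mem_supportIdeals {S : Finset (Ideal (𝓞 K))} (hS : S ⊆ primeFinset K γ M) :
    ∏ 𝔭 ∈ S, 𝔭 ∈ supportIdeals K γ M := by
  refine ⟨squarefree_prod_of_isPrime (isPrime_of_subset_primeFinset hS), fun 𝔭 h𝔭 => ?_⟩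
  rw [primeFactors_prod_of_isPrime (isPrime_of_subset_primeFinset hS)] at h𝔭
  exact (Set.Finite.mem_toFinset _).1 (hS h𝔭)

theorem injOn_prod_powerset_primeFinset :
    Set.InjOn (fun S : Finset (Ideal (𝓞 K)) => ∏ 𝔭 ∈ S, 𝔭)
      {S | S ⊆ primeFinset K γ M} := by
  intro R hR S hS h
  have h1 := primeFactors_prod_of_isPrime (isPrime_of_subset_primeFinset hR)
  have h2 := primeFactors_prod_of_isPrime (isPrime_of_subset_primeFinset hS)
  rw [← h1, ← h2]
  exact congrArg _ h

theorem injOn_prod_goodSets :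
    Set.InjOn (fun S : Finset (Ideal (𝓞 K)) => ∏ 𝔭 ∈ S, 𝔭) (goodSets K γ a M) :=
  injOn_prod_powerset_primeFinset.mono fun _ h => subset_primeFinset_of_mem_goodSets h

theorem resonatorSet_eq : resonatorSet K γ a M =
    ((goodSets K γ a M).image fun S => ∏ 𝔭 ∈ S, 𝔭 : Finset (Ideal (𝓞 K))) := by
  ext 𝔫
  simp only [Finset.coe_image, Set.mem_image, SetLike.mem_coe]
  constructor
  · rintro ⟨⟨hsq, hsub⟩, hcard⟩
    refine ⟨primeFactors 𝔫, Finset.mem_filter.2 ⟨Finset.mem_powerset.2 fun 𝔭 h𝔭 => ?_, hcard⟩,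
      prod_primeFactors_of_squarefree hsq⟩
    exact (Set.Finite.mem_toFinset _).2 (hsub 𝔭 h𝔭)
  · rintro ⟨S, hS, rfl⟩
    have hP := subset_primeFinset_of_mem_goodSets hS
    refine ⟨prod_mem_supportIdeals hP, fun k hk => ?_⟩
    rw [primeFactors_prod_of_isPrime (isPrime_of_subset_primeFinset hP)]
    exact (Finset.mem_filter.1 hS).2 k hk

theorem encard_resonatorSet : (resonatorSet K γ a M).encard = (goodSets K γ a M).card := by
  rw [resonatorSet_eq, Set.encard_coe_eq_coe_finsetCard,
    Finset.card_image_of_injOn injOn_prod_goodSets]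

theorem resonator_prod {S : Finset (Ideal (𝓞 K))} (hS : S ⊆ primeFinset K γ M) :
    resonator γ M (∏ 𝔭 ∈ S, 𝔭) = ∏ 𝔭 ∈ S, primeValue M 𝔭 := by
  rw [resonator, if_pos (prod_mem_supportIdeals hS),
    primeFactors_prod_of_isPrime (isPrime_of_subset_primeFinset hS)]
  rfl

theorem finsum_resonator_sq :
    ∑ᶠ 𝔪 ∈ resonatorSet K γ a M, resonator γ M 𝔪 ^ 2 =
      ∑ S ∈ goodSets K γ a M, ∏ 𝔭 ∈ S, primeValue M 𝔭 ^ 2 := by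
  rw [resonatorSet_eq, finsum_mem_coe_finset, Finset.sum_image injOn_prod_goodSets]
  refine Finset.sum_congr rfl fun S hS => ?_
  rw [resonator_prod (subset_primeFinset_of_mem_goodSets hS), Finset.prod_pow]

theorem normQuot_prod {R S : Finset (Ideal (𝓞 K))} (hS : S ⊆ primeFinset K γ M) (hRS : R ⊆ S) :
    normQuot (∏ 𝔭 ∈ S, 𝔭) (∏ 𝔭 ∈ R, 𝔭) = ∏ 𝔭 ∈ S \ R, (Ideal.absNorm 𝔭 : ℝ) := by
  have hne : (∏ 𝔭 ∈ R, (Ideal.absNorm 𝔭 : ℝ)) ≠ 0 := Finset.prod_ne_zero_iff.2 fun 𝔭 h𝔭 => by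
    exact_mod_cast (absNorm_pos (isPrime_of_mem_primeFinset (hS (hRS h𝔭))).2).ne'
  rw [normQuot, map_prod, map_prod, Nat.cast_prod, Nat.cast_prod, div_eq_iff hne,
    Finset.prod_sdiff hRS]

theorem resonancePairs_eq : resonancePairs K γ a M D =
    (((goodSets K γ a M).sigma fun S => S.powerset.filter fun R =>
      ∏ 𝔭 ∈ S \ R, (Ideal.absNorm 𝔭 : ℝ) < √(D : ℝ)).image
        fun x => (∏ 𝔭 ∈ x.2, 𝔭, ∏ 𝔭 ∈ x.1, 𝔭) : Finset (Ideal (𝓞 K) × Ideal (𝓞 K))) := by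
  ext ⟨𝔪, 𝔫⟩
  simp only [Finset.coe_image, Set.mem_image, SetLike.mem_coe, Finset.mem_sigma, Finset.mem_filter,
    Finset.mem_powerset, Sigma.exists, Prod.mk.injEq]
  constructor
  · rintro ⟨h1, h2, hdvd, hnorm⟩
    simp only [resonatorSet_eq, Finset.coe_image, Set.mem_image, SetLike.mem_coe] at h1 h2
    obtain ⟨R, hR, rfl⟩ := h1
    obtain ⟨S, hS, rfl⟩ := h2
    have hSP := subset_primeFinset_of_mem_goodSets hS
    have hRS : R ⊆ S := (prod_dvd_prod_iff_subset (isPrime_of_subset_primeFinset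
      (subset_primeFinset_of_mem_goodSets hR)) (isPrime_of_subset_primeFinset hSP)).1 hdvd
    refine ⟨S, R, ⟨hS, hRS, ?_⟩, rfl, rfl⟩
    rwa [← normQuot_prod hSP hRS]
  · rintro ⟨S, R, ⟨hS, hRS, hnorm⟩, rfl, rfl⟩
    have hSP := subset_primeFinset_of_mem_goodSets hS
    refine ⟨?_, ?_, ?_, ?_⟩
    · simp only [resonatorSet_eq, Finset.coe_image]
      exact ⟨R, goodSets_mono hS hRS, rfl⟩
    · simp only [resonatorSet_eq, Finset.coe_image]
      exact ⟨S, hS, rfl⟩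
    · exact (prod_dvd_prod_iff_subset (isPrime_of_subset_primeFinset (hRS.trans hSP))
        (isPrime_of_subset_primeFinset hSP)).2 hRS
    · simp only
      rwa [normQuot_prod hSP hRS]

theorem finsum_resonancePairs :
    ∑ᶠ x ∈ resonancePairs K γ a M D,
      resonator γ M x.1 * resonator γ M x.2 / √(normQuot x.2 x.1) =
    ∑ S ∈ goodSets K γ a M, ∑ R ∈ S.powerset with
        ∏ 𝔭 ∈ S \ R, (Ideal.absNorm 𝔭 : ℝ) < √(D : ℝ),
      (∏ 𝔭 ∈ R, primeValue M 𝔭 ^ 2) *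
        ∏ 𝔭 ∈ S \ R, primeValue M 𝔭 / √(Ideal.absNorm 𝔭 : ℝ) := by
  rw [resonancePairs_eq, finsum_mem_coe_finset, Finset.sum_image, Finset.sum_sigma]
  · refine Finset.sum_congr rfl fun S hS => Finset.sum_congr rfl fun R hR => ?_
    have hSP := subset_primeFinset_of_mem_goodSets hS
    have hRS : R ⊆ S := Finset.mem_powerset.1 (Finset.mem_filter.1 hR).1
    simp only
    rw [resonator_prod hSP, resonator_prod (hRS.trans hSP), normQuot_prod hSP hRS,
      Real.sqrt_prod _ fun 𝔭 _ => Nat.cast_nonneg _, Finset.prod_div_distrib, Finset.prod_pow,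
      ← Finset.prod_sdiff hRS]
    ring
  · rintro ⟨S, R⟩ hx ⟨S', R'⟩ hx' h
    simp only [Finset.coe_sigma, Set.mem_sigma_iff, SetLike.mem_coe, Finset.mem_filter,
      Finset.mem_powerset, Prod.mk.injEq] at hx hx' h
    have hS := subset_primeFinset_of_mem_goodSets hx.1
    have hS' := subset_primeFinset_of_mem_goodSets hx'.1
    obtain rfl : S = S' := injOn_prod_powerset_primeFinset hS hS' h.2
    obtain rfl : R = R' :=
      injOn_prod_powerset_primeFinset (hx.2.1.trans hS) (hx'.2.1.trans hS) h.1
    rfl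

theorem amplitude_mul_primeSum :
    amplitude M * primeSum K γ M =
      ∑ 𝔭 ∈ primeFinset K γ M, primeValue M 𝔭 / √(Ideal.absNorm 𝔭 : ℝ) := by
  rw [primeSum, ← Set.Finite.coe_toFinset (resonatorPrimes_finite K γ M), finsum_mem_coe_finset,
    Finset.mul_sum]
  refine Finset.sum_congr rfl fun 𝔭 _ => ?_
  rw [primeValue]
  ring

end Translation

section Asymptotics

theorem iterLog_succ (k : ℕ) (x : ℝ) : iterLog (k + 1) x = Real.log (iterLog k x) :=
  Function.iterate_succ_apply' _ _ _

theorem tendsto_iterLog_atTop (k : ℕ) : Tendsto (fun M : ℕ => iterLog k M) atTop atTop := by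
  induction k with
  | zero => simpa [iterLog] using tendsto_natCast_atTop_atTop (R := ℝ)
  | succ k ih =>
    simp_rw [iterLog_succ]
    exact Real.tendsto_log_atTop.comp ih

theorem eventually_iterLog_one_eq : ∀ᶠ M : ℕ in atTop, iterLog 1 M = Real.exp (iterLog 2 M) := by
  filter_upwards [(tendsto_iterLog_atTop 1).eventually_gt_atTop 0] with M hM
  rw [iterLog_succ 1, Real.exp_log hM]

theorem eventually_amplitude_le :
    ∀ᶠ M : ℕ in atTop, amplitude M ≤ iterLog 2 M * Real.exp (iterLog 2 M / 2) := by
  filter_upwards [eventually_iterLog_one_eq, (tendsto_iterLog_atTop 2).eventually_ge_atTop 1,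
    (tendsto_iterLog_atTop 3).eventually_ge_atTop 1] with M h1 h2 h3
  rw [amplitude, h1]
  refine Real.sqrt_le_iff.2 ⟨by positivity, ?_⟩
  have hsq : Real.exp (iterLog 2 M / 2) ^ 2 = Real.exp (iterLog 2 M) := by
    rw [← Real.exp_nat_mul]
    congr 1
    push_cast
    ring
  rw [mul_pow, hsq]
  refine (div_le_self (by positivity) h3).trans ?_
  have : iterLog 2 M ≤ iterLog 2 M ^ 2 := by nlinarith
  nlinarith [Real.exp_pos (iterLog 2 M)]

theorem eventually_amplitude_mul_le {δ : ℝ} (hδ : 0 < δ) :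
    ∀ᶠ M : ℕ in atTop, amplitude M * iterLog 3 M ≤ δ * iterLog 1 M := by
  have h := (Real.tendsto_pow_mul_exp_neg_atTop_nhds_zero 2).comp
    ((tendsto_iterLog_atTop 2).atTop_div_const (r := 2) (by norm_num))
  filter_upwards [eventually_iterLog_one_eq, (tendsto_iterLog_atTop 2).eventually_ge_atTop 1,
    (tendsto_iterLog_atTop 3).eventually_ge_atTop 1, eventually_amplitude_le,
    h.eventually_lt_const (u := δ / 4) (by positivity)] with M h1 h2 h3 hA hsmall
  have h32 : iterLog 3 M ≤ iterLog 2 M := by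
    rw [iterLog_succ 2]
    exact Real.log_le_self (by linarith)
  simp only [Function.comp] at hsmall
  set x := iterLog 2 M
  have hexp : Real.exp x = Real.exp (x / 2) * Real.exp (x / 2) := by
    rw [← Real.exp_add]
    ring_nf
  rw [Real.exp_neg, ← div_eq_mul_inv, div_lt_iff₀ (Real.exp_pos _)] at hsmall
  rw [h1, hexp]
  calc amplitude M * iterLog 3 M ≤ (x * Real.exp (x / 2)) * x :=
        mul_le_mul hA h32 (by linarith) (by positivity)
    _ = (4 * (x / 2) ^ 2) * Real.exp (x / 2) := by ring
    _ ≤ (δ * Real.exp (x / 2)) * Real.exp (x / 2) :=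
        mul_le_mul_of_nonneg_right (by linarith) (Real.exp_pos _).le
    _ = _ := by ring

/-- Total weight of the sets of prime ideals with too many elements in some shell. -/
def shellError (c : ℝ) (M : ℕ) : ℝ :=
  iterLog 2 M * Real.exp (-(c * iterLog 1 M / (iterLog 3 M * iterLog 2 M)))

/-- Total weight of the pairs whose quotient has large norm. -/
def normError (C : ℝ) (M : ℕ) : ℝ :=
  Real.exp (-(iterLog 1 M / (2 * iterLog 2 M)) + C * amplitude M)

theorem tendsto_shellError {c : ℝ} (hc : 0 < c) : Tendsto (shellError c) atTop (𝓝 0) := by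
  have hlim : Tendsto (fun M : ℕ => iterLog 2 M * Real.exp (-iterLog 2 M)) atTop (𝓝 0) := by
    simpa [Function.comp_def] using (Real.tendsto_pow_mul_exp_neg_atTop_nhds_zero 1).comp (tendsto_iterLog_atTop 2)
  have h := (Real.tendsto_pow_mul_exp_neg_atTop_nhds_zero 3).comp (tendsto_iterLog_atTop 2)
  refine tendsto_of_tendsto_of_tendsto_of_le_of_le' tendsto_const_nhds hlim ?_ ?_
  · filter_upwards [(tendsto_iterLog_atTop 2).eventually_ge_atTop 1] with M h2
    exact mul_nonneg (by linarith) (Real.exp_pos _).le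
  · filter_upwards [eventually_iterLog_one_eq, (tendsto_iterLog_atTop 2).eventually_ge_atTop 1,
      (tendsto_iterLog_atTop 3).eventually_ge_atTop 1, h.eventually_lt_const hc]
      with M h1 h2 h3 hsmall
    have h32 : iterLog 3 M ≤ iterLog 2 M := by
      rw [iterLog_succ 2]
      exact Real.log_le_self (by linarith)
    simp only [Function.comp] at hsmall
    rw [Real.exp_neg, ← div_eq_mul_inv, div_lt_iff₀ (Real.exp_pos _), ← h1] at hsmall
    refine mul_le_mul_of_nonneg_left (Real.exp_le_exp.2 (neg_le_neg ?_)) (by linarith)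
    rw [le_div_iff₀ (by positivity)]
    refine le_trans ?_ hsmall.le
    nlinarith [mul_nonneg (sub_nonneg.2 h32) (sq_nonneg (iterLog 2 M))]

theorem tendsto_normError {C : ℝ} (hC : 0 ≤ C) : Tendsto (normError C) atTop (𝓝 0) := by
  have hlim : Tendsto (fun M : ℕ => Real.exp (-iterLog 2 M)) atTop (𝓝 0) :=
    Real.tendsto_exp_neg_atTop_nhds_zero.comp (tendsto_iterLog_atTop 2)
  have h := (Real.tendsto_pow_mul_exp_neg_atTop_nhds_zero 2).comp (tendsto_iterLog_atTop 2)
  have h' := (Real.tendsto_pow_mul_exp_neg_atTop_nhds_zero 2).comp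
    ((tendsto_iterLog_atTop 2).atTop_div_const (r := 2) (by norm_num))
  refine tendsto_of_tendsto_of_tendsto_of_le_of_le' tendsto_const_nhds hlim ?_ ?_
  · exact Eventually.of_forall fun M => (Real.exp_pos _).le
  · filter_upwards [eventually_iterLog_one_eq, (tendsto_iterLog_atTop 2).eventually_ge_atTop 1,
      eventually_amplitude_le, h.eventually_lt_const (u := 1 / 4) (by norm_num),
      h'.eventually_lt_const (u := 1 / (16 * (C + 1))) (by positivity)] with M h1 h2 hA hs hs'
    simp only [Function.comp] at hs hs'
    refine Real.exp_le_exp.2 ?_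
    set x := iterLog 2 M
    have hexp : Real.exp x = Real.exp (x / 2) * Real.exp (x / 2) := by
      rw [← Real.exp_add]
      ring_nf
    rw [Real.exp_neg, ← div_eq_mul_inv, div_lt_iff₀ (Real.exp_pos _)] at hs hs'
    have hC1 : 0 < C + 1 := by linarith
    have hs2 : (C + 1) * x ^ 2 ≤ Real.exp (x / 2) / 4 := by
      have : (C + 1) * (x / 2) ^ 2 ≤ (C + 1) * (1 / (16 * (C + 1)) * Real.exp (x / 2)) :=
        mul_le_mul_of_nonneg_left hs'.le hC1.le
      have h3 : (C + 1) * (1 / (16 * (C + 1)) * Real.exp (x / 2)) = Real.exp (x / 2) / 16 := by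
        field_simp
      nlinarith
    have hCA : C * amplitude M ≤ C * (x * Real.exp (x / 2)) := mul_le_mul_of_nonneg_left hA hC
    have hterm : x + C * (x * Real.exp (x / 2)) ≤ Real.exp x / (2 * x) := by
      rw [le_div_iff₀ (by positivity)]
      have h4 : x * (2 * x) ≤ Real.exp x / 2 := by nlinarith
      have h5 : C * x ^ 2 ≤ Real.exp (x / 2) / 4 := by nlinarith [sq_nonneg x]
      have h6 : C * (x * Real.exp (x / 2)) * (2 * x) ≤ Real.exp x / 2 := by
        rw [hexp]
        nlinarith [Real.exp_pos (x / 2)]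
      nlinarith
    rw [h1]
    linarith

theorem eventually_count_bound {γ a : ℝ} (haγ : a * γ < 1) (C : ℝ) :
    ∀ᶠ M : ℕ in atTop, iterLog 1 M / iterLog 3 M *
      (a * (γ * iterLog 3 M + 2 * Real.log (iterLog 3 M)) + C) ≤ iterLog 1 M := by
  have hlog : Tendsto (fun M : ℕ => Real.log (iterLog 3 M) / iterLog 3 M) atTop (𝓝 0) := by
    have := Real.isLittleO_log_id_atTop.tendsto_div_nhds_zero.comp (tendsto_iterLog_atTop 3)
    exact this
  have hinv : Tendsto (fun M : ℕ => C / iterLog 3 M) atTop (𝓝 0) :=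
    (tendsto_iterLog_atTop 3).const_div_atTop C
  have hlim : Tendsto (fun M : ℕ => a * γ + 2 * a * (Real.log (iterLog 3 M) / iterLog 3 M) +
      C / iterLog 3 M) atTop (𝓝 (a * γ)) := by
    simpa using ((hlog.const_mul (2 * a)).const_add (a * γ)).add hinv
  filter_upwards [hlim.eventually_lt_const haγ, (tendsto_iterLog_atTop 3).eventually_ge_atTop 1,
    (tendsto_iterLog_atTop 1).eventually_ge_atTop 1] with M h h3 h1
  have h30 : iterLog 3 M ≠ 0 := by linarith
  have : iterLog 1 M / iterLog 3 M *
      (a * (γ * iterLog 3 M + 2 * Real.log (iterLog 3 M)) + C) =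
      iterLog 1 M * (a * γ + 2 * a * (Real.log (iterLog 3 M) / iterLog 3 M) +
        C / iterLog 3 M) := by
    field_simp
  rw [this]
  nlinarith

end Asymptotics

section Shells

open Module

theorem log_iterLog_mul {M : ℕ} (h1 : 0 < iterLog 1 M) (h2 : 0 < iterLog 2 M) :
    Real.log (iterLog 1 M * iterLog 2 M) = iterLog 2 M + iterLog 3 M := by
  rw [Real.log_mul h1.ne' h2.ne', ← iterLog_succ, ← iterLog_succ]

/-- The sum of `1/p` over the prime ideals of a shell. -/
theorem eventually_sum_shellPrimes_le {δ : ℝ} (hδ : 0 < δ) :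
    ∀ᶠ M : ℕ in atTop, ∀ (K : Type*) [Field K] [NumberField K], finrank ℚ K ≤ 2 → ∀ k : ℕ,
      ∑ 𝔭 ∈ (shellPrimes_finite K M k).toFinset, 1 / (primeBelow 𝔭 : ℝ) ≤
        2 * (1 + δ) / iterLog 2 M := by
  obtain ⟨x₀, hx₀⟩ := eventually_atTop.1 (eventually_sum_one_div_prime_le hδ)
  filter_upwards [(tendsto_iterLog_atTop 1).eventually_ge_atTop (max x₀ 1),
    (tendsto_iterLog_atTop 2).eventually_ge_atTop 1,
    (tendsto_iterLog_atTop 3).eventually_ge_atTop 0] with M h1 h2 h3 K _ _ hK k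
  have h11 : 1 ≤ iterLog 1 M := (le_max_right _ _).trans h1
  have hpos : 0 < iterLog 1 M * iterLog 2 M := by positivity
  have hek : 1 ≤ Real.exp k := Real.one_le_exp k.cast_nonneg
  set x := Real.exp k * (iterLog 1 M * iterLog 2 M) with hx
  have hxge : x₀ ≤ x := by
    have : iterLog 1 M ≤ iterLog 1 M * iterLog 2 M := le_mul_of_one_le_right (by linarith) h2
    exact ((le_max_left _ _).trans h1).trans (this.trans (le_mul_of_one_le_left hpos.le hek))
  have hlogx : iterLog 2 M ≤ Real.log x := by
    rw [hx, Real.log_mul (Real.exp_pos _).ne' hpos.ne', Real.log_exp,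
      log_iterLog_mul (by linarith) (by linarith)]
    have : (0 : ℝ) ≤ k := k.cast_nonneg
    linarith
  have hmem : ∀ 𝔭 ∈ (shellPrimes_finite K M k).toFinset, 𝔭 ∈ shellPrimes K M k := fun 𝔭 h =>
    (Set.Finite.mem_toFinset _).1 h
  refine (sum_comp_primeBelow_le hK _ (fun 𝔭 h => ⟨(hmem 𝔭 h).1, (hmem 𝔭 h).2.1⟩)
    (φ := fun p => 1 / (p : ℝ)) fun n => by positivity).trans ?_
  have hsum := hx₀ x hxge ((shellPrimes_finite K M k).toFinset.image primeBelow) fun p hp => by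
    obtain ⟨𝔭, h𝔭, rfl⟩ := Finset.mem_image.1 hp
    obtain ⟨hp1, hp2, hp3, hp4⟩ := hmem 𝔭 h𝔭
    refine ⟨primeBelow_prime hp1 hp2, hp3, hp4.trans_eq ?_⟩
    rw [hx, Real.exp_add]
    ring
  rw [mul_div_assoc]
  refine mul_le_mul_of_nonneg_left (hsum.trans ?_) zero_le_two
  exact div_le_div_of_nonneg_left (by linarith) (by linarith) hlogx

variable {K : Type*} [Field K] {M k : ℕ} {𝔭 : Ideal (𝓞 K)}

theorem primeBelow_pos_of_mem_shellPrimes (h𝔭 : 𝔭 ∈ shellPrimes K M k) :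
    (0 : ℝ) < primeBelow 𝔭 := by
  exact_mod_cast (primeBelow_prime h𝔭.1 h𝔭.2.1).pos

theorem lt_log_primeBelow_sub (h1 : 0 < iterLog 1 M) (h2 : 0 < iterLog 2 M)
    (h𝔭 : 𝔭 ∈ shellPrimes K M k) :
    (k : ℝ) < Real.log (primeBelow 𝔭) - iterLog 2 M - iterLog 3 M := by
  have hpos : 0 < iterLog 1 M * iterLog 2 M := by positivity
  have := Real.log_lt_log (by positivity) h𝔭.2.2.1
  rw [Real.log_mul (Real.exp_pos _).ne' hpos.ne', Real.log_exp, log_iterLog_mul h1 h2] at this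
  linarith

theorem primeWeight_pos (h1 : 0 < iterLog 1 M) (h2 : 0 < iterLog 2 M)
    (h𝔭 : 𝔭 ∈ shellPrimes K M k) : 0 < primeWeight M 𝔭 := by
  have hp := primeBelow_pos_of_mem_shellPrimes h𝔭
  have hd := lt_log_primeBelow_sub h1 h2 h𝔭
  have hd0 : 0 < Real.log (primeBelow 𝔭) - iterLog 2 M - iterLog 3 M :=
    lt_of_le_of_lt k.cast_nonneg hd
  rw [primeWeight]
  positivity

theorem primeWeight_le (h1 : 0 < iterLog 1 M) (h2 : 0 < iterLog 2 M) (hk : 1 ≤ k)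
    (h𝔭 : 𝔭 ∈ shellPrimes K M k) : primeWeight M 𝔭 ≤ 1 / (√(primeBelow 𝔭 : ℝ) * k) := by
  have hp := primeBelow_pos_of_mem_shellPrimes h𝔭
  have hd := lt_log_primeBelow_sub h1 h2 h𝔭
  have hk0 : (0 : ℝ) < k := by exact_mod_cast hk
  rw [primeWeight]
  exact one_div_le_one_div_of_le (by positivity)
    (mul_le_mul_of_nonneg_left hd.le (Real.sqrt_nonneg _))

theorem amplitude_sq (h1 : 0 < iterLog 1 M) (h2 : 0 < iterLog 2 M) (h3 : 0 < iterLog 3 M) :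
    amplitude M ^ 2 = iterLog 1 M * iterLog 2 M / iterLog 3 M :=
  Real.sq_sqrt (by positivity)

theorem primeValue_nonneg (h1 : 0 < iterLog 1 M) (h2 : 0 < iterLog 2 M)
    (h𝔭 : 𝔭 ∈ shellPrimes K M k) : 0 ≤ primeValue M 𝔭 :=
  mul_nonneg (Real.sqrt_nonneg _) (primeWeight_pos h1 h2 h𝔭).le

theorem primeValue_sq_le (h1 : 0 < iterLog 1 M) (h2 : 0 < iterLog 2 M) (h3 : 0 < iterLog 3 M)
    (hk : 1 ≤ k) (h𝔭 : 𝔭 ∈ shellPrimes K M k) :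
    primeValue M 𝔭 ^ 2 ≤
      iterLog 1 M * iterLog 2 M / ((k : ℝ) ^ 2 * iterLog 3 M) * (1 / primeBelow 𝔭) := by
  have hp := primeBelow_pos_of_mem_shellPrimes h𝔭
  have hk0 : (0 : ℝ) < k := by exact_mod_cast hk
  rw [primeValue, mul_pow, amplitude_sq h1 h2 h3]
  refine (mul_le_mul_of_nonneg_left (pow_le_pow_left₀ (primeWeight_pos h1 h2 h𝔭).le
    (primeWeight_le h1 h2 hk h𝔭) 2) (by positivity)).trans_eq ?_
  rw [div_pow, mul_pow, Real.sq_sqrt hp.le]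
  field_simp

theorem primeValue_sq_le_one_div (h1 : 0 < iterLog 1 M) (h2 : 0 < iterLog 2 M)
    (h3 : 0 < iterLog 3 M) (hk : 1 ≤ k) (h𝔭 : 𝔭 ∈ shellPrimes K M k) :
    primeValue M 𝔭 ^ 2 ≤ 1 / iterLog 3 M := by
  have hp := primeBelow_pos_of_mem_shellPrimes h𝔭
  have hk0 : (1 : ℝ) ≤ k := by exact_mod_cast hk
  have hpos : 0 < iterLog 1 M * iterLog 2 M := by positivity
  have hy : iterLog 1 M * iterLog 2 M ≤ primeBelow 𝔭 :=
    (le_mul_of_one_le_left hpos.le (Real.one_le_exp k.cast_nonneg)).trans h𝔭.2.2.1.le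
  refine (primeValue_sq_le h1 h2 h3 hk h𝔭).trans ?_
  rw [div_mul_div_comm, mul_one, div_le_div_iff₀ (by positivity) h3, one_mul]
  have hk2 : (1 : ℝ) ≤ (k : ℝ) ^ 2 := one_le_pow₀ hk0
  calc iterLog 1 M * iterLog 2 M * iterLog 3 M ≤ primeBelow 𝔭 * iterLog 3 M :=
        mul_le_mul_of_nonneg_right hy h3.le
    _ ≤ (k : ℝ) ^ 2 * (primeBelow 𝔭 * iterLog 3 M) := le_mul_of_one_le_left (by positivity) hk2
    _ = _ := by ring

variable [NumberField K]

theorem primeValue_div_sqrt_nonneg (h1 : 0 < iterLog 1 M) (h2 : 0 < iterLog 2 M)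
    (h𝔭 : 𝔭 ∈ shellPrimes K M k) : 0 ≤ primeValue M 𝔭 / √(Ideal.absNorm 𝔭 : ℝ) :=
  div_nonneg (primeValue_nonneg h1 h2 h𝔭) (Real.sqrt_nonneg _)

theorem primeValue_div_sqrt_le (h1 : 0 < iterLog 1 M) (h2 : 0 < iterLog 2 M)
    (hk : 1 ≤ k) (h𝔭 : 𝔭 ∈ shellPrimes K M k) :
    primeValue M 𝔭 / √(Ideal.absNorm 𝔭 : ℝ) ≤ amplitude M / k * (1 / primeBelow 𝔭) := by
  have hp := primeBelow_pos_of_mem_shellPrimes h𝔭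
  have hk0 : (0 : ℝ) < k := by exact_mod_cast hk
  have hN : √(primeBelow 𝔭 : ℝ) ≤ √(Ideal.absNorm 𝔭 : ℝ) :=
    Real.sqrt_le_sqrt (by exact_mod_cast primeBelow_le_absNorm h𝔭.2.1)
  have hA : 0 ≤ amplitude M := Real.sqrt_nonneg _
  have hsp : 0 < √(primeBelow 𝔭 : ℝ) := Real.sqrt_pos.2 hp
  calc primeValue M 𝔭 / √(Ideal.absNorm 𝔭 : ℝ)
      ≤ primeValue M 𝔭 / √(primeBelow 𝔭 : ℝ) :=
        div_le_div_of_nonneg_left (primeValue_nonneg h1 h2 h𝔭) hsp hN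
    _ ≤ amplitude M * (1 / (√(primeBelow 𝔭 : ℝ) * k)) / √(primeBelow 𝔭 : ℝ) :=
        div_le_div_of_nonneg_right
          (mul_le_mul_of_nonneg_left (primeWeight_le h1 h2 hk h𝔭) hA) hsp.le
    _ = amplitude M / k * (1 / (√(primeBelow 𝔭 : ℝ) * √(primeBelow 𝔭 : ℝ))) := by
        field_simp
    _ = _ := by rw [Real.mul_self_sqrt hp.le]

theorem primeValue_div_sqrt_le_one_div (h1 : 0 < iterLog 1 M) (h2 : 0 < iterLog 2 M)
    (h3 : 0 < iterLog 3 M) (hA : amplitude M * iterLog 3 M ≤ iterLog 1 M * iterLog 2 M)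
    (hk : 1 ≤ k) (h𝔭 : 𝔭 ∈ shellPrimes K M k) :
    primeValue M 𝔭 / √(Ideal.absNorm 𝔭 : ℝ) ≤ 1 / iterLog 3 M := by
  have hp := primeBelow_pos_of_mem_shellPrimes h𝔭
  have hk0 : (1 : ℝ) ≤ k := by exact_mod_cast hk
  have hpos : 0 < iterLog 1 M * iterLog 2 M := by positivity
  have hy : iterLog 1 M * iterLog 2 M ≤ primeBelow 𝔭 :=
    (le_mul_of_one_le_left hpos.le (Real.one_le_exp k.cast_nonneg)).trans h𝔭.2.2.1.le
  refine (primeValue_div_sqrt_le h1 h2 hk h𝔭).trans ?_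
  rw [div_mul_div_comm, mul_one, div_le_div_iff₀ (by positivity) h3, one_mul]
  exact (hA.trans hy).trans (le_mul_of_one_le_left hp.le hk0)

theorem absNorm_rpow_le (hK : finrank ℚ K ≤ 2) (h1 : 0 < iterLog 1 M) (h2 : 0 < iterLog 2 M)
    (h32 : iterLog 3 M ≤ iterLog 2 M) (hk : (k : ℝ) + 1 ≤ iterLog 2 M)
    (h𝔭 : 𝔭 ∈ shellPrimes K M k) :
    (Ideal.absNorm 𝔭 : ℝ) ^ (1 / iterLog 2 M) ≤ Real.exp 6 := by
  have hp := primeBelow_pos_of_mem_shellPrimes h𝔭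
  have hN0 : (0 : ℝ) < Ideal.absNorm 𝔭 := by exact_mod_cast absNorm_pos h𝔭.2.1
  have hpos : 0 < iterLog 1 M * iterLog 2 M := by positivity
  have hN : (Ideal.absNorm 𝔭 : ℝ) ≤ (primeBelow 𝔭 : ℝ) ^ 2 := by
    exact_mod_cast absNorm_le_primeBelow_sq hK h𝔭.1 h𝔭.2.1
  have hlogp := Real.log_le_log hp h𝔭.2.2.2
  rw [Real.log_mul (Real.exp_pos _).ne' hpos.ne', Real.log_exp, log_iterLog_mul h1 h2] at hlogp
  have hlogN := Real.log_le_log hN0 hN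
  rw [Real.log_pow] at hlogN
  push_cast at hlogN
  rw [Real.rpow_def_of_pos hN0]
  refine Real.exp_le_exp.2 ?_
  rw [mul_one_div, div_le_iff₀ h2]
  linarith

end Shells

section Main

open Module
open scoped Classical

theorem shellCount_le {γ : ℝ} {M : ℕ} (h2 : 0 ≤ iterLog 2 M) :
    (shellCount γ M : ℝ) ≤ iterLog 2 M ^ γ := Nat.floor_le (Real.rpow_nonneg h2 _)

theorem add_one_le_of_mem_Icc {γ : ℝ} {M k : ℕ} (h2 : 0 ≤ iterLog 2 M)
    (hk : k ∈ Finset.Icc 1 (shellCount γ M - 1)) : (k : ℝ) + 1 ≤ iterLog 2 M ^ γ := by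
  rw [Finset.mem_Icc] at hk
  refine le_trans ?_ (shellCount_le h2)
  have : k + 1 ≤ shellCount γ M := by omega
  exact_mod_cast this

theorem sq_le_of_mem_Icc {γ : ℝ} (hγ : γ < 1 / 2) {M k : ℕ} (h2 : 1 ≤ iterLog 2 M)
    (hk : k ∈ Finset.Icc 1 (shellCount γ M - 1)) : (k : ℝ) ^ 2 ≤ iterLog 2 M := by
  have h := (add_one_le_of_mem_Icc (by linarith) hk).trans
    (Real.rpow_le_rpow_of_exponent_le h2 hγ.le)
  rw [← Real.sqrt_eq_rpow] at h
  have hk0 : (0 : ℝ) ≤ k := k.cast_nonneg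
  exact (Real.le_sqrt hk0 (by linarith)).1 (by linarith)

theorem rpow_le_self_of_lt_half {γ : ℝ} (hγ : γ < 1 / 2) {x : ℝ} (hx : 1 ≤ x) : x ^ γ ≤ x := by
  simpa using Real.rpow_le_rpow_of_exponent_le hx (show γ ≤ 1 by linarith)

theorem sum_filter_primeFinset_le {K : Type*} [Field K] [NumberField K] {γ : ℝ} {M k : ℕ}
    {g : Ideal (𝓞 K) → ℝ} (hg : ∀ 𝔭 ∈ shellPrimes K M k, 0 ≤ g 𝔭) :
    ∑ 𝔭 ∈ primeFinset K γ M with 𝔭 ∈ shellPrimes K M k, g 𝔭 ≤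
      ∑ 𝔭 ∈ (shellPrimes_finite K M k).toFinset, g 𝔭 := by
  refine Finset.sum_le_sum_of_subset_of_nonneg (fun 𝔭 h => ?_) fun 𝔭 h _ => ?_
  · exact (Set.Finite.mem_toFinset _).2 (Finset.mem_filter.1 h).2
  · exact hg 𝔭 ((Set.Finite.mem_toFinset _).1 h)

theorem sum_primeFinset_le {K : Type*} [Field K] [NumberField K] {γ : ℝ} {M : ℕ}
    {g : Ideal (𝓞 K) → ℝ}
    (hg : ∀ k ∈ Finset.Icc 1 (shellCount γ M - 1), ∀ 𝔭 ∈ shellPrimes K M k, 0 ≤ g 𝔭) :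
    ∑ 𝔭 ∈ primeFinset K γ M, g 𝔭 ≤ ∑ k ∈ Finset.Icc 1 (shellCount γ M - 1),
      ∑ 𝔭 ∈ (shellPrimes_finite K M k).toFinset, g 𝔭 := by
  refine le_trans ?_ (Finset.sum_le_sum fun k hk => sum_filter_primeFinset_le (γ := γ) (hg k hk))
  simp_rw [Finset.sum_filter]
  rw [Finset.sum_comm]
  refine Finset.sum_le_sum fun 𝔭 h𝔭 => ?_
  obtain ⟨k, hk, hmem⟩ := mem_primeFinset.1 h𝔭
  have h0 : ∀ l ∈ Finset.Icc 1 (shellCount γ M - 1),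
      0 ≤ if 𝔭 ∈ shellPrimes K M l then g 𝔭 else 0 := fun l hl => by
    split_ifs with h
    · exact hg l hl 𝔭 h
    · exact le_rfl
  have := Finset.single_le_sum h0 hk
  rwa [if_pos hmem] at this

theorem sum_Icc_one_div_le {γ : ℝ} (hγ : 0 < γ) {M : ℕ} (h2 : 1 ≤ iterLog 2 M) :
    ∑ k ∈ Finset.Icc 1 (shellCount γ M - 1), 1 / (k : ℝ) ≤ 1 + γ * iterLog 3 M := by
  have h := harmonic_le_one_add_log (shellCount γ M - 1)
  rw [harmonic_eq_sum_Icc] at h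
  push_cast at h
  simp_rw [one_div]
  refine h.trans ?_
  have hlog : Real.log (iterLog 2 M ^ γ) = γ * iterLog 3 M := by
    rw [Real.log_rpow (by linarith), iterLog_succ 2]
  rw [← hlog]
  have hle : ((shellCount γ M - 1 : ℕ) : ℝ) ≤ iterLog 2 M ^ γ :=
    le_trans (by exact_mod_cast Nat.sub_le _ _) (shellCount_le (by linarith))
  rcases Nat.eq_zero_or_pos (shellCount γ M - 1) with h0 | h0
  · rw [h0, Nat.cast_zero, Real.log_zero, add_zero]
    have := Real.log_nonneg (Real.one_le_rpow h2 hγ.le)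
    linarith
  · have := Real.log_le_log (by exact_mod_cast h0) hle
    linarith

theorem sum_Icc_one_div_sq_le (n : ℕ) : ∑ k ∈ Finset.Icc 1 n, 1 / (k : ℝ) ^ 2 ≤ 2 := by
  have h := sum_Ioc_inv_sq_le_sub (α := ℝ) (k := 1) (n := max n 1) one_ne_zero (le_max_right _ _)
  have hsub : Finset.Icc 1 n ⊆ insert 1 (Finset.Ioc 1 (max n 1)) := fun k hk => by
    rw [Finset.mem_Icc] at hk
    rw [Finset.mem_insert, Finset.mem_Ioc]
    have := le_max_left n 1
    omega
  refine (Finset.sum_le_sum_of_subset_of_nonneg hsub fun _ _ _ => by positivity).trans ?_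
  rw [Finset.sum_insert (by simp)]
  simp_rw [one_div]
  have h0 : (0 : ℝ) ≤ ((max n 1 : ℕ) : ℝ)⁻¹ := by positivity
  simp only [Nat.cast_one, inv_one, one_pow] at h ⊢
  linarith

theorem summable_log_div_sq : Summable fun k : ℕ => Real.log k / (k : ℝ) ^ 2 := by
  have h : Summable fun k : ℕ => 2 * (1 / (k : ℝ) ^ (3 / 2 : ℝ)) :=
    (Real.summable_one_div_nat_rpow.2 (by norm_num)).mul_left 2
  refine Summable.of_nonneg_of_le (fun k => div_nonneg (Real.log_natCast_nonneg k) (by positivity))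
    (fun k => ?_) h
  rcases Nat.eq_zero_or_pos k with rfl | hk
  · simp
  have hk0 : (0 : ℝ) < k := by exact_mod_cast hk
  have hlog := Real.log_natCast_le_rpow_div k (ε := 1 / 2) (by norm_num)
  rw [mul_one_div, div_le_div_iff₀ (by positivity) (by positivity)]
  have hsq : (k : ℝ) ^ 2 = (k : ℝ) ^ (1 / 2 : ℝ) * (k : ℝ) ^ (3 / 2 : ℝ) := by
    rw [← Real.rpow_add hk0]
    norm_num
  rw [hsq, ← mul_assoc]
  refine mul_le_mul_of_nonneg_right ?_ (by positivity)
  linarith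

/-- The set `𝓜` has at most `M` elements. -/
theorem eventually_card_goodSets_le {γ a : ℝ} (hγ : 0 < γ) (ha : 0 < a) (haγ : a * γ < 1) :
    ∀ᶠ M : ℕ in atTop, ∀ (K : Type*) [Field K] [NumberField K], finrank ℚ K ≤ 2 →
      (goodSets K γ a M).card ≤ M := by
  set C₀ := ∑' k : ℕ, Real.log k / (k : ℝ) ^ 2 with hC₀
  filter_upwards [eventually_sum_shellPrimes_le one_pos,
    eventually_count_bound haγ (a * (1 + 2 * C₀) + 8 * Real.exp 1),
    (tendsto_iterLog_atTop 1).eventually_ge_atTop 1,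
    (tendsto_iterLog_atTop 2).eventually_ge_atTop 1,
    (tendsto_iterLog_atTop 3).eventually_ge_atTop 1, eventually_ge_atTop 1]
    with M hshell hcount h1 h2 h3 hM K _ _ hK
  set J := Finset.Icc 1 (shellCount γ M - 1) with hJ
  have hJ0 : ∀ k ∈ J, (1 : ℝ) ≤ k := fun k hk => by
    exact_mod_cast (Finset.mem_Icc.1 hk).1
  set z : ℕ → ℝ := fun k => Real.exp (-k) / ((k : ℝ) ^ 2 * iterLog 3 M) with hz
  have hz0 : ∀ k ∈ J, 0 < z k := fun k hk => by
    have := hJ0 k hk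
    simp only [hz]
    positivity
  have hz1 : ∀ k ∈ J, z k ≤ 1 := fun k hk => by
    have hk1 := hJ0 k hk
    have hk2 : (1 : ℝ) ≤ (k : ℝ) ^ 2 := one_le_pow₀ hk1
    have h5 : 1 ≤ (k : ℝ) ^ 2 * iterLog 3 M := one_le_mul_of_one_le_of_one_le hk2 h3
    refine (div_le_one (by linarith)).2 (le_trans ?_ h5)
    exact Real.exp_le_one_iff.2 (by linarith)
  have hlogz : ∀ k ∈ J, -Real.log (z k) = k + 2 * Real.log k + Real.log (iterLog 3 M) :=
    fun k hk => by
      have hk1 := hJ0 k hk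
      simp only [hz]
      rw [Real.log_div (Real.exp_pos _).ne' (by positivity), Real.log_exp,
        Real.log_mul (by positivity) (by positivity), Real.log_pow]
      push_cast
      ring
  have hcard : ∀ k ∈ J, (((primeFinset K γ M).filter (· ∈ shellPrimes K M k)).card : ℝ) * z k ≤
      iterLog 1 M / iterLog 3 M * (4 * Real.exp 1 * (1 / (k : ℝ) ^ 2)) := fun k hk => by
    have hk1 := hJ0 k hk
    have hcardle : (((primeFinset K γ M).filter (· ∈ shellPrimes K M k)).card : ℝ) ≤
        Real.exp (k + 1) * (iterLog 1 M * iterLog 2 M) * (2 * (1 + 1) / iterLog 2 M) := by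
      refine le_trans ?_ (mul_le_mul_of_nonneg_left (hshell K hK k) (by positivity))
      have hle := sum_filter_primeFinset_le (K := K) (γ := γ) (M := M) (k := k)
        (g := fun _ => (1 : ℝ)) fun _ _ => zero_le_one
      rw [Finset.sum_const, nsmul_one] at hle
      refine hle.trans ?_
      rw [Finset.mul_sum]
      refine Finset.sum_le_sum fun 𝔭 h𝔭 => ?_
      have hmem := (Set.Finite.mem_toFinset _).1 h𝔭
      rw [mul_one_div, le_div_iff₀ (primeBelow_pos_of_mem_shellPrimes hmem), one_mul]
      exact hmem.2.2.2
    refine (mul_le_mul_of_nonneg_right hcardle (hz0 k hk).le).trans_eq ?_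
    simp only [hz]
    rw [Real.exp_add, Real.exp_neg]
    field_simp
    ring
  have hsumJ : ∑ k ∈ J, (a * iterLog 1 M / ((k : ℝ) ^ 2 * iterLog 3 M) * -Real.log (z k) +
      (((primeFinset K γ M).filter (· ∈ shellPrimes K M k)).card : ℝ) * z k) ≤ iterLog 1 M := by
    calc _ ≤ ∑ k ∈ J, iterLog 1 M / iterLog 3 M * (a * (1 / k + 2 * (Real.log k / (k : ℝ) ^ 2) +
          Real.log (iterLog 3 M) * (1 / (k : ℝ) ^ 2)) + 4 * Real.exp 1 * (1 / (k : ℝ) ^ 2)) := by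
          refine Finset.sum_le_sum fun k hk => ?_
          have hk1 := hJ0 k hk
          rw [mul_add (iterLog 1 M / iterLog 3 M)]
          refine add_le_add (le_of_eq ?_) (hcard k hk)
          rw [hlogz k hk]
          field_simp
      _ = iterLog 1 M / iterLog 3 M * (a * (∑ k ∈ J, 1 / (k : ℝ) +
          2 * ∑ k ∈ J, Real.log k / (k : ℝ) ^ 2 +
          Real.log (iterLog 3 M) * ∑ k ∈ J, 1 / (k : ℝ) ^ 2) +
            4 * Real.exp 1 * ∑ k ∈ J, 1 / (k : ℝ) ^ 2) := by
          simp only [Finset.mul_sum, ← Finset.sum_add_distrib]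
      _ ≤ iterLog 1 M / iterLog 3 M * (a * ((1 + γ * iterLog 3 M) + 2 * C₀ +
          Real.log (iterLog 3 M) * 2) + 4 * Real.exp 1 * 2) := by
          have hl3 : 0 ≤ Real.log (iterLog 3 M) := Real.log_nonneg h3
          have hs1 := sum_Icc_one_div_le hγ h2
          have hs2 := sum_Icc_one_div_sq_le (shellCount γ M - 1)
          have hs3 : ∑ k ∈ J, Real.log k / (k : ℝ) ^ 2 ≤ C₀ :=
            summable_log_div_sq.sum_le_tsum _ fun k _ =>
              div_nonneg (Real.log_natCast_nonneg k) (by positivity)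
          gcongr
      _ ≤ iterLog 1 M := by
          refine le_trans (le_of_eq ?_) hcount
          ring
  have hmain := card_filter_powerset_le (primeFinset K γ M) J
    (fun k 𝔭 => 𝔭 ∈ shellPrimes K M k) (fun 𝔭 h𝔭 => mem_primeFinset.1 h𝔭)
    (fun k => a * iterLog 1 M / ((k : ℝ) ^ 2 * iterLog 3 M)) hz0 hz1
  have hexp : Real.exp (iterLog 1 M) = M := by
    rw [iterLog_succ 0]
    exact Real.exp_log (by simpa [iterLog] using Nat.lt_of_succ_le hM)
  have hfinal := hmain.trans ((Real.exp_le_exp.2 hsumJ).trans_eq hexp)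
  have : (goodSets K γ a M).card = ((primeFinset K γ M).powerset.filter fun S =>
      ∀ k ∈ J, ((S.filter fun 𝔭 => 𝔭 ∈ shellPrimes K M k).card : ℝ) <
        a * iterLog 1 M / ((k : ℝ) ^ 2 * iterLog 3 M)).card := by
    unfold goodSets
    congr
  rw [this]
  exact_mod_cast hfinal

end Main

section LowerBound

open Module
open scoped Classical

theorem exists_rankin_constants {a : ℝ} (ha : 2 < a) :
    ∃ δ c : ℝ, 0 < δ ∧ δ ≤ 1 ∧ 0 < c ∧
      (a / 2 - 1) * (2 * (1 + δ) ^ 2) + c ≤ a * Real.log (a / 2) := by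
  set b := a / 2 with hb
  have hb1 : 1 < b := by linarith
  have hb0 : 0 < b := by linarith
  have hlog : b - 1 < b * Real.log b := by
    have h := Real.log_lt_sub_one_of_pos (inv_pos.2 hb0) (inv_ne_one.2 hb1.ne')
    rw [Real.log_inv] at h
    have h2 := mul_lt_mul_of_pos_left h hb0
    rw [mul_sub, mul_inv_cancel₀ hb0.ne'] at h2
    linarith
  set g := a * Real.log b - 2 * (b - 1) with hg
  have hg0 : 0 < g := by
    have : a = 2 * b := by linarith
    rw [hg, this]
    linarith
  have hbm : 0 < b - 1 := by linarith
  refine ⟨min 1 (g / (12 * (b - 1))), g / 2, by positivity, min_le_left _ _, by positivity, ?_⟩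
  set δ := min 1 (g / (12 * (b - 1))) with hδ
  have hδ0 : 0 < δ := by positivity
  have hδ1 : δ ≤ 1 := min_le_left _ _
  have hδ2 : δ * (12 * (b - 1)) ≤ g := (le_div_iff₀ (by positivity)).1 (min_le_right _ _)
  have hsq : (1 + δ) ^ 2 ≤ 1 + 3 * δ := by nlinarith
  have h3 := mul_le_mul_of_nonneg_left hsq hbm.le
  nlinarith

theorem sum_shell_weight_le {K : Type*} [Field K] [NumberField K] {M k : ℕ} {δ : ℝ} (hδ : 0 ≤ δ)
    (h1 : 0 < iterLog 1 M) (h2 : 0 < iterLog 2 M) (h3 : 0 < iterLog 3 M) (hk : 1 ≤ k)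
    (hk2 : (k : ℝ) ≤ iterLog 2 M) (hA : amplitude M * iterLog 3 M ≤ δ * iterLog 1 M)
    (hshell : ∑ 𝔭 ∈ (shellPrimes_finite K M k).toFinset, 1 / (primeBelow 𝔭 : ℝ) ≤
      2 * (1 + δ) / iterLog 2 M) :
    ∑ 𝔭 ∈ (shellPrimes_finite K M k).toFinset,
        (primeValue M 𝔭 ^ 2 + primeValue M 𝔭 / √(Ideal.absNorm 𝔭 : ℝ)) ≤
      2 * (1 + δ) ^ 2 * (iterLog 1 M / ((k : ℝ) ^ 2 * iterLog 3 M)) := by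
  have hk0 : (0 : ℝ) < k := by exact_mod_cast hk
  have hA0 : 0 ≤ amplitude M := Real.sqrt_nonneg _
  have hAk : amplitude M / k ≤ δ * (iterLog 1 M * iterLog 2 M / ((k : ℝ) ^ 2 * iterLog 3 M)) := by
    rw [mul_div_assoc', div_le_div_iff₀ hk0 (by positivity)]
    calc amplitude M * ((k : ℝ) ^ 2 * iterLog 3 M)
        = amplitude M * iterLog 3 M * (k : ℝ) ^ 2 := by ring
      _ ≤ δ * iterLog 1 M * (k : ℝ) ^ 2 := mul_le_mul_of_nonneg_right hA (by positivity)
      _ = δ * iterLog 1 M * k * k := by ring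
      _ ≤ δ * iterLog 1 M * k * iterLog 2 M := mul_le_mul_of_nonneg_left hk2 (by positivity)
      _ = _ := by ring
  calc _ ≤ ∑ 𝔭 ∈ (shellPrimes_finite K M k).toFinset,
        (1 + δ) * (iterLog 1 M * iterLog 2 M / ((k : ℝ) ^ 2 * iterLog 3 M)) *
          (1 / (primeBelow 𝔭 : ℝ)) := by
        refine Finset.sum_le_sum fun 𝔭 h𝔭 => ?_
        have hmem := (Set.Finite.mem_toFinset _).1 h𝔭
        have hp := primeBelow_pos_of_mem_shellPrimes hmem
        have hu := primeValue_sq_le h1 h2 h3 hk hmem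
        have hv := (primeValue_div_sqrt_le h1 h2 hk hmem).trans
          (mul_le_mul_of_nonneg_right hAk (one_div_nonneg.2 hp.le))
        refine (add_le_add hu hv).trans_eq ?_
        ring
    _ = (1 + δ) * (iterLog 1 M * iterLog 2 M / ((k : ℝ) ^ 2 * iterLog 3 M)) *
          ∑ 𝔭 ∈ (shellPrimes_finite K M k).toFinset, 1 / (primeBelow 𝔭 : ℝ) := by
        rw [Finset.mul_sum]
    _ ≤ (1 + δ) * (iterLog 1 M * iterLog 2 M / ((k : ℝ) ^ 2 * iterLog 3 M)) *
          (2 * (1 + δ) / iterLog 2 M) := mul_le_mul_of_nonneg_left hshell (by positivity)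
    _ = _ := by
        field_simp

/-- The resonance ratio is at least the untruncated Euler product, up to the Rankin errors. -/
theorem exists_eventually_le_resonanceRatio {γ a : ℝ} (hγ : γ < 1 / 2) (ha : 2 < a) :
    ∃ c C : ℝ, 0 < c ∧ 0 ≤ C ∧
      ∀ᶠ M : ℕ in atTop, ∀ (K : Type*) [Field K] [NumberField K], finrank ℚ K ≤ 2 →
        ∀ D : ℕ, M ≤ D →
          Real.exp ((1 - 2 * (1 / iterLog 3 M)) * (amplitude M * primeSum K γ M)) *
            (1 - shellError c M - normError C M) ≤ resonanceRatio K γ a M D := by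
  obtain ⟨δ, c, hδ, hδ1, hc, hbc⟩ := exists_rankin_constants ha
  refine ⟨c, 4 * Real.exp 6, hc, by positivity, ?_⟩
  filter_upwards [eventually_sum_shellPrimes_le hδ, eventually_amplitude_mul_le hδ,
    (tendsto_iterLog_atTop 1).eventually_ge_atTop 1,
    (tendsto_iterLog_atTop 2).eventually_ge_atTop 1,
    (tendsto_iterLog_atTop 3).eventually_ge_atTop 1, eventually_ge_atTop 1,
    (tendsto_shellError hc).eventually_lt_const (u := 1 / 2) (by norm_num),
    (tendsto_normError (C := 4 * Real.exp 6) (by positivity)).eventually_lt_const (u := 1 / 2)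
      (by norm_num)]
    with M hshell hA h1 h2 h3 hM herr1 herr2 K _ _ hK D hMD
  have h10 : 0 < iterLog 1 M := by linarith
  have h20 : 0 < iterLog 2 M := by linarith
  have h30 : 0 < iterLog 3 M := by linarith
  have h32 : iterLog 3 M ≤ iterLog 2 M := by
    rw [iterLog_succ 2]
    exact Real.log_le_self h20.le
  have hA0 : 0 ≤ amplitude M := Real.sqrt_nonneg _
  have hA' : amplitude M * iterLog 3 M ≤ iterLog 1 M * iterLog 2 M := by nlinarith
  set J := Finset.Icc 1 (shellCount γ M - 1) with hJ
  have hJ1 : ∀ k ∈ J, 1 ≤ k := fun k hk => (Finset.mem_Icc.1 hk).1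
  have hJ2 : ∀ k ∈ J, (k : ℝ) + 1 ≤ iterLog 2 M := fun k hk =>
    (add_one_le_of_mem_Icc h20.le hk).trans (rpow_le_self_of_lt_half hγ h2)
  have hJcard : (J.card : ℝ) ≤ iterLog 2 M := by
    rw [hJ, Nat.card_Icc]
    refine le_trans ?_ ((shellCount_le h20.le).trans (rpow_le_self_of_lt_half hγ h2))
    have : shellCount γ M - 1 + 1 - 1 ≤ shellCount γ M := by omega
    exact_mod_cast this
  set P := primeFinset K γ M with hP
  set u : Ideal (𝓞 K) → ℝ := fun 𝔭 => primeValue M 𝔭 ^ 2 with hu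
  set v : Ideal (𝓞 K) → ℝ := fun 𝔭 => primeValue M 𝔭 / √(Ideal.absNorm 𝔭 : ℝ) with hv
  set N : Ideal (𝓞 K) → ℝ := fun 𝔭 => (Ideal.absNorm 𝔭 : ℝ) with hN
  set T : ℕ → ℝ := fun k => a * iterLog 1 M / ((k : ℝ) ^ 2 * iterLog 3 M) with hT
  have hu0 : ∀ 𝔭 ∈ P, 0 ≤ u 𝔭 := fun 𝔭 _ => sq_nonneg _
  have hvshell : ∀ k, ∀ 𝔭 ∈ shellPrimes K M k, 0 ≤ v 𝔭 := fun k 𝔭 h =>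
    primeValue_div_sqrt_nonneg h10 h20 h
  have hv0 : ∀ 𝔭 ∈ P, 0 ≤ v 𝔭 := fun 𝔭 h𝔭 => by
    obtain ⟨k, hk, hmem⟩ := mem_primeFinset.1 h𝔭
    exact hvshell k 𝔭 hmem
  have hN0 : ∀ 𝔭 ∈ P, 0 < N 𝔭 := fun 𝔭 h𝔭 => by
    simp only [hN]
    exact_mod_cast absNorm_pos (isPrime_of_mem_primeFinset h𝔭).2
  have huε : ∀ 𝔭 ∈ P, u 𝔭 ≤ 1 / iterLog 3 M := fun 𝔭 h𝔭 => by
    obtain ⟨k, hk, hmem⟩ := mem_primeFinset.1 h𝔭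
    exact primeValue_sq_le_one_div h10 h20 h30 (hJ1 k hk) hmem
  have hvε : ∀ 𝔭 ∈ P, v 𝔭 ≤ 1 / iterLog 3 M := fun 𝔭 h𝔭 => by
    obtain ⟨k, hk, hmem⟩ := mem_primeFinset.1 h𝔭
    exact primeValue_div_sqrt_le_one_div h10 h20 h30 hA' (hJ1 k hk) hmem
  have hM0 : (0 : ℝ) < M := by exact_mod_cast hM
  have hD0 : (0 : ℝ) < D := lt_of_lt_of_le hM0 (by exact_mod_cast hMD)
  have hX : 0 < √(D : ℝ) := Real.sqrt_pos.2 hD0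
  have hb : 1 ≤ a / 2 := by linarith
  have hnum := prod_mul_one_sub_le_sum P hu0 hv0 hN0 hX (α := 1 / iterLog 2 M) (by positivity)
    J (fun k 𝔭 => 𝔭 ∈ shellPrimes K M k) T hb
  have hshellErr : ∑ k ∈ J, Real.exp (-(T k * Real.log (a / 2)) + (a / 2 - 1) *
      ∑ 𝔭 ∈ P with 𝔭 ∈ shellPrimes K M k, (u 𝔭 + v 𝔭)) ≤ shellError c M := by
    calc _ ≤ ∑ k ∈ J, Real.exp (-(c * iterLog 1 M / (iterLog 3 M * iterLog 2 M))) := by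
          refine Finset.sum_le_sum fun k hk => Real.exp_le_exp.2 ?_
          have hk0 : (0 : ℝ) < k := by exact_mod_cast hJ1 k hk
          have hw := (sum_filter_primeFinset_le (γ := γ) (g := fun 𝔭 => u 𝔭 + v 𝔭)
            fun 𝔭 h => add_nonneg (sq_nonneg _) (hvshell k 𝔭 h)).trans
            (sum_shell_weight_le hδ.le h10 h20 h30 (hJ1 k hk) (by linarith [hJ2 k hk]) hA
              (hshell K hK k))
          set Q := iterLog 1 M / ((k : ℝ) ^ 2 * iterLog 3 M) with hQ
          have hQ0 : 0 ≤ Q := by positivity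
          have hTQ : T k = a * Q := by
            simp only [hT, hQ]
            ring
          have hQge : iterLog 1 M / (iterLog 3 M * iterLog 2 M) ≤ Q := by
            refine div_le_div_of_nonneg_left h10.le (by positivity) ?_
            rw [mul_comm]
            exact mul_le_mul_of_nonneg_left (sq_le_of_mem_Icc hγ h2 hk) h30.le
          have hw' := mul_le_mul_of_nonneg_left hw (sub_nonneg.2 hb)
          have hbQ := mul_le_mul_of_nonneg_right hbc hQ0
          have hcQ := mul_le_mul_of_nonneg_left hQge hc.le
          rw [hTQ, mul_div_assoc]
          linarith
      _ = (J.card : ℝ) * Real.exp (-(c * iterLog 1 M / (iterLog 3 M * iterLog 2 M))) := by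
          rw [Finset.sum_const, nsmul_eq_mul]
      _ ≤ _ := mul_le_mul_of_nonneg_right hJcard (Real.exp_pos _).le
  have hnormErr : Real.exp (-(1 / iterLog 2 M * Real.log √(D : ℝ)) +
      ∑ 𝔭 ∈ P, v 𝔭 * N 𝔭 ^ (1 / iterLog 2 M)) ≤ normError (4 * Real.exp 6) M := by
    refine Real.exp_le_exp.2 (add_le_add (neg_le_neg ?_) ?_)
    · have hlog : iterLog 1 M ≤ Real.log D := by
        rw [iterLog_succ 0]
        exact Real.log_le_log (by simpa [iterLog] using Nat.lt_of_succ_le hM) (by simpa [iterLog] using hMD)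
      rw [Real.log_sqrt hD0.le, div_le_iff₀ (by positivity)]
      field_simp
      linarith
    · calc _ ≤ ∑ k ∈ J, ∑ 𝔭 ∈ (shellPrimes_finite K M k).toFinset,
            v 𝔭 * N 𝔭 ^ (1 / iterLog 2 M) :=
            sum_primeFinset_le fun k _ 𝔭 h => mul_nonneg (hvshell k 𝔭 h) (by positivity)
        _ ≤ ∑ k ∈ J, ∑ 𝔭 ∈ (shellPrimes_finite K M k).toFinset,
            amplitude M * Real.exp 6 * (1 / (primeBelow 𝔭 : ℝ)) := by
            refine Finset.sum_le_sum fun k hk => Finset.sum_le_sum fun 𝔭 h𝔭 => ?_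
            have hmem := (Set.Finite.mem_toFinset _).1 h𝔭
            have hp := primeBelow_pos_of_mem_shellPrimes hmem
            have hk1 : (1 : ℝ) ≤ k := by exact_mod_cast hJ1 k hk
            have hv1 : v 𝔭 ≤ amplitude M * (1 / (primeBelow 𝔭 : ℝ)) :=
              (primeValue_div_sqrt_le h10 h20 (hJ1 k hk) hmem).trans
                (mul_le_mul_of_nonneg_right (div_le_self hA0 hk1) (by positivity))
            have hN1 := absNorm_rpow_le hK h10 h20 h32 (hJ2 k hk) hmem
            refine (mul_le_mul hv1 hN1 (by positivity) (by positivity)).trans_eq ?_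
            ring
        _ ≤ ∑ k ∈ J, amplitude M * Real.exp 6 * (2 * (1 + δ) / iterLog 2 M) := by
            refine Finset.sum_le_sum fun k _ => ?_
            rw [← Finset.mul_sum]
            exact mul_le_mul_of_nonneg_left (hshell K hK k) (by positivity)
        _ = (J.card : ℝ) * (amplitude M * Real.exp 6 * (2 * (1 + δ) / iterLog 2 M)) := by
            rw [Finset.sum_const, nsmul_eq_mul]
        _ ≤ iterLog 2 M * (amplitude M * Real.exp 6 * (2 * (1 + δ) / iterLog 2 M)) :=
            mul_le_mul_of_nonneg_right hJcard (by positivity)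
        _ = amplitude M * Real.exp 6 * (2 * (1 + δ)) := by
            field_simp
        _ ≤ amplitude M * Real.exp 6 * 4 :=
            mul_le_mul_of_nonneg_left (by linarith) (by positivity)
        _ = _ := by ring
  have hgood : goodSets K γ a M = P.powerset.filter fun S =>
      ∀ k ∈ J, ((S.filter fun 𝔭 => 𝔭 ∈ shellPrimes K M k).card : ℝ) < T k := by
    unfold goodSets
    congr
  rw [resonanceRatio, finsum_resonator_sq, finsum_resonancePairs, amplitude_mul_primeSum, hgood]
  set Y := Real.exp ((1 - 2 * (1 / iterLog 3 M)) * ∑ 𝔭 ∈ P, v 𝔭) with hY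
  set G := P.powerset.filter fun S =>
      ∀ k ∈ J, ((S.filter fun 𝔭 => 𝔭 ∈ shellPrimes K M k).card : ℝ) < T k with hG
  have hprod := exp_le_prod_one_add_div P hu0 hv0 huε hvε
  have hfull0 : 0 ≤ ∏ 𝔭 ∈ P, (1 + (u 𝔭 + v 𝔭)) := Finset.prod_nonneg fun 𝔭 h𝔭 => by
    linarith [hu0 𝔭 h𝔭, hv0 𝔭 h𝔭]
  have hterm0 : ∀ S ∈ P.powerset, 0 ≤ ∏ 𝔭 ∈ S, u 𝔭 := fun S _ =>
    Finset.prod_nonneg fun 𝔭 _ => sq_nonneg _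
  have hdenle : ∑ S ∈ G, ∏ 𝔭 ∈ S, u 𝔭 ≤ ∏ 𝔭 ∈ P, (1 + u 𝔭) := by
    rw [Finset.prod_one_add]
    exact Finset.sum_le_sum_of_subset_of_nonneg (Finset.filter_subset _ _) fun S hS _ => hterm0 S hS
  have hempty : ∅ ∈ G := by
    refine Finset.mem_filter.2 ⟨Finset.empty_mem_powerset _, fun k hk => ?_⟩
    have hk0 : (0 : ℝ) < k := by exact_mod_cast hJ1 k hk
    simp only [Finset.filter_empty, Finset.card_empty, Nat.cast_zero, hT]
    positivity
  have hdenpos : 0 < ∑ S ∈ G, ∏ 𝔭 ∈ S, u 𝔭 := by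
    have := Finset.single_le_sum (f := fun S => ∏ 𝔭 ∈ S, u 𝔭)
      (fun S hS => hterm0 S (Finset.filter_subset _ _ hS)) hempty
    rw [Finset.prod_empty] at this
    linarith
  have herr : 0 ≤ 1 - shellError c M - normError (4 * Real.exp 6) M := by linarith
  rw [one_div_mul_eq_div, le_div_iff₀ hdenpos]
  calc Y * (1 - shellError c M - normError (4 * Real.exp 6) M) * ∑ S ∈ G, ∏ 𝔭 ∈ S, u 𝔭
      ≤ Y * (1 - shellError c M - normError (4 * Real.exp 6) M) * ∏ 𝔭 ∈ P, (1 + u 𝔭) :=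
        mul_le_mul_of_nonneg_left hdenle (mul_nonneg (Real.exp_pos _).le herr)
    _ = (Y * ∏ 𝔭 ∈ P, (1 + u 𝔭)) * (1 - shellError c M - normError (4 * Real.exp 6) M) := by ring
    _ ≤ (∏ 𝔭 ∈ P, (1 + (u 𝔭 + v 𝔭))) * (1 - shellError c M - normError (4 * Real.exp 6) M) :=
        mul_le_mul_of_nonneg_right hprod herr
    _ ≤ _ := le_trans (mul_le_mul_of_nonneg_left (by linarith) hfull0) hnum

end LowerBound

end Resonance

end

theorem proposition3p1 (γ a : ℝ) (hγ : 0 < γ) (hγ' : γ < 1 / 2) (ha : 2 < a) (ha' : a < 1 / γ) :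
    ∃ ε₁ ε₂ : ℕ → ℝ, Tendsto ε₁ atTop (𝓝 0) ∧ Tendsto ε₂ atTop (𝓝 0) ∧
      ∃ M₀ : ℕ, ∀ M : ℕ, M₀ ≤ M →
        ∀ D : ℕ, Resonance.IsFundamentalDiscriminant (-(D : ℤ)) →
          ∀ (K : Type*) [Field K] [NumberField K], Resonance.IsQSqrtNeg D K →
            (Resonance.resonatorSet K γ a M).encard ≤ M ∧
            (M ≤ D →
              Real.exp ((1 + ε₁ M) * (Resonance.amplitude M * Resonance.primeSum K γ M) + ε₂ M) ≤
                Resonance.resonanceRatio K γ a M D) := by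
  obtain ⟨c, C, hc, hC, hratio⟩ := Resonance.exists_eventually_le_resonanceRatio hγ' ha
  have hcard := Resonance.eventually_card_goodSets_le hγ (by linarith : 0 < a)
    ((lt_div_iff₀ hγ).1 ha')
  have herr : Tendsto (fun M => 1 - Resonance.shellError c M - Resonance.normError C M) atTop
      (𝓝 1) := by
    simpa using ((Resonance.tendsto_shellError hc).const_sub 1).sub (Resonance.tendsto_normError hC)
  refine ⟨fun M => -(2 * (1 / Resonance.iterLog 3 M)),
    fun M => Real.log (1 - Resonance.shellError c M - Resonance.normError C M), ?_, ?_, ?_⟩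
  · simpa using
      (((Resonance.tendsto_iterLog_atTop 3).const_div_atTop 1).const_mul 2).neg
  · simpa using herr.log one_ne_zero
  · obtain ⟨M₀, hM₀⟩ := eventually_atTop.1
      ((hratio.and hcard).and (herr.eventually_const_lt (u := 0) one_pos))
    refine ⟨M₀, fun M hM D _ K _ _ hK => ?_⟩
    obtain ⟨⟨hr, hn⟩, hpos⟩ := hM₀ M hM
    refine ⟨?_, fun hMD => ?_⟩
    · rw [Resonance.encard_resonatorSet]
      exact_mod_cast hn K hK.finrank_le_two
    · rw [Real.exp_add, Real.exp_log hpos, ← sub_eq_add_neg]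
      exact hr K hK.finrank_le_two D hMD
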